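/- Composition is written in diagrammatic order ($f;g$ means first $f$, then $g$), and coherence isomorphisms of monoidal categories are suppressed. **Definitions.** An *additive symmetric monoidal category* is a symmetric monoidal category $(\mathbb X,\otimes,K,\sigma)$ whose hom-sets are commutative monoids $(+,0)$ such that composition and $\otimes$ preserve sums and zeros in each variable (neither negatives nor biproducts are assumed). A *coalgebra modality* $(!,\delta,\varepsilon,\Delta,e)$ on a symmetric monoidal category is a comonad $(!,\delta,\varepsilon)$ with natural transformations $\Delta:{!A}\to{!A}\otimes{!A}$ and $e:{!A}\to K$ making each $!A$ a cocommutative comonoid, such that $\delta;\Delta=\Delta;(\delta\otimes\delta)$. * It is *monoidal* when it is equipped with $m_\otimes:{!A}\otimes{!B}\to{!(A\otimes B)}$ and $m_K:K\to{!K}$ making $!$ a symmetric (lax) monoidal functor, such that $\delta,\varepsilon,\Delta,e$ are monoidal transformations and $\Delta$ and $e$ are $!$-coalgebra morphisms, i.e. $\delta;{!(\Delta)}=\Delta;(\delta\otimes\delta);m_\otimes$ and $\delta;{!(e)}=e;m_K$. An *additive linear category* is an additive symmetric monoidal category with a monoidal coalgebra modality. * In the presence of finite products (terminal object $T$), it *has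 Seely isomorphisms* if the maps $\chi=\Delta;({!\pi_0}\otimes{!\pi_1}):{!(A\times B)}\to{!A}\otimes{!B}$ and $\chi_T=e:{!T}\to K$ are isomorphisms. An *additive monoidal storage category* is an additive symmetric monoidal category with finite products and a coalgebra modality which has Seely isomorphisms. * On an additive symmetric monoidal category, it is an *additive bialgebra modality* when it is equipped with natural transformations $\nabla:{!A}\otimes{!A}\to{!A}$ and $u:K\to{!A}$ such that $({!A},\nabla,u)$ is a commutative monoid, $({!A},\nabla,u,\Delta,e)$ is a bialgebra, $\nabla;\varepsilon=\varepsilon\otimes e+e\otimes\varepsilon$, and, for all parallel $f,g$, ${!(f+g)}=\Delta;({!f}\otimes{!g});\nabla$ and ${!(0)}=e;u$. **Theorem.** Let $\mathbb X$ be an additive symmetric monoidal category. The following are equivalent structures on $\mathbb X$: 1. an additive monoidal storage category (finite products, and a coalgebra modality which has Seely isomorphisms); 2. an additive linear category with finite biproducts (finite biproducts, and a monoidal coalgebra modality); 3. finite biproducts, and an additive bialgebra modality. More precisely, for every coalgebra modality $(!,\delta,\varepsilon,\Delta,e)$ on $\mathbb X$ the structures of kinds (1), (2), (3) with this underlying coalgebra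 modality are in bijective correspondence, and the correspondences are as follows. * (1) and (2): $m_\otimes=\chi^{-1};\delta;{!(\chi)};{!(\varepsilon\otimes\varepsilon)}$ and $m_K=\chi_T^{-1};\delta;{!(\chi_T)}$; in the other direction $\chi^{-1}=(\delta\otimes\delta);m_\otimes;{!(\langle\varepsilon\otimes e,\,e\otimes\varepsilon\rangle)}$ and $\chi_T^{-1}=m_K;{!(t)}$, where $t:K\to T$ is the unique map. * (2) to (3): $\nabla=(\delta\otimes\delta);m_\otimes;{!(\varepsilon\otimes e+e\otimes\varepsilon)}$ and $u=m_K;{!(0)}$. * (1) to (3): $\nabla=\chi^{-1};{!(\nabla_\times)}$, where $\nabla_\times:A\times A\to A$ is the codiagonal of the biproduct, and $u=\chi_0^{-1};{!(0)}$, where $\chi_0=e:{!0}\to K$ is the Seely map at the zero object. * (3) to (1): the inverses of the Seely isomorphisms are $$\chi^{-1}=({!(\iota_0)}\otimes{!(\iota_1)});\nabla:{!A}\otimes{!B}\to{!(A\times B)},\qquad \chi_0^{-1}=u:K\to{!0},$$ where $\iota_0,\iota_1$ are the injections of the biproduct $A\times B$ and $0$ is the zero object. -/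

import Mathlib

open CategoryTheory CategoryTheory.Limits MonoidalCategory

universe v u

/-- An additive category in the sense of a category enriched in commutative monoids:
no negatives and no biproducts are assumed. -/
class CMonCategory (C : Type u) [Category.{v} C] where
  homAddCommMonoid : ∀ X Y : C, AddCommMonoid (X ⟶ Y)
  add_comp : ∀ {X Y Z : C} (f g : X ⟶ Y) (h : Y ⟶ Z), (f + g) ≫ h = f ≫ h + g ≫ h
  comp_add : ∀ {X Y Z : C} (k : X ⟶ Y) (f g : Y ⟶ Z), k ≫ (f + g) = k ≫ f + k ≫ g
  zero_comp : ∀ (X : C) {Y Z : C} (h : Y ⟶ Z), (0 : X ⟶ Y) ≫ h = 0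
  comp_zero : ∀ {X Y : C} (k : X ⟶ Y) (Z : C), k ≫ (0 : Y ⟶ Z) = 0

attribute [reducible, instance] CMonCategory.homAddCommMonoid

/-- The zeros of the hom-monoids are the zero morphisms. -/
instance CMonCategory.hasZeroMorphisms (C : Type u) [Category.{v} C] [CMonCategory C] :
    HasZeroMorphisms C where
  zero X Y := ⟨(0 : X ⟶ Y)⟩
  comp_zero f Z := CMonCategory.comp_zero f Z
  zero_comp X _ _ f := CMonCategory.zero_comp X f

/-- Compatibility of the tensor product with the additive structure: together with
`[SymmetricCategory C]` and `[CMonCategory C]` this makes `C` an additive symmetric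
monoidal category. -/
class MonoidalCMonCategory (C : Type u) [Category.{v} C] [MonoidalCategory C]
    [CMonCategory C] : Prop where
  tensor_add : ∀ {W X Y Z : C} (k : W ⟶ X) (f g : Y ⟶ Z), k ⊗ₘ (f + g) = k ⊗ₘ f + k ⊗ₘ g
  add_tensor : ∀ {W X Y Z : C} (f g : W ⟶ X) (h : Y ⟶ Z), (f + g) ⊗ₘ h = f ⊗ₘ h + g ⊗ₘ h
  tensor_zero : ∀ {W X : C} (k : W ⟶ X) (Y Z : C), k ⊗ₘ (0 : Y ⟶ Z) = 0
  zero_tensor : ∀ (W X : C) {Y Z : C} (h : Y ⟶ Z), (0 : W ⟶ X) ⊗ₘ h = 0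

/-- A coalgebra modality on a symmetric monoidal category: a comonad `(!, δ, ε)` together with
natural cocommutative comonoid structures `(Δ, e)` on the objects `!A` such that `δ` preserves
the comultiplication. That every `!f` is a comonoid morphism is the naturality of `Δ` and `e`. -/
structure CoalgebraModality (C : Type u) [Category.{v} C] [MonoidalCategory C]
    [SymmetricCategory C] extends Comonad C where
  comon : ∀ A : C, ComonObj (obj A)
  comm : ∀ A : C, IsCommComonObj (obj A)
  map_isComonHom : ∀ {A B : C} (f : A ⟶ B), IsComonHom (map f)
  δ_comul : ∀ A : C, δ.app A ≫ (comon (obj A)).comul =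
    (comon A).comul ≫ (δ.app A ⊗ₘ δ.app A)

namespace CoalgebraModality

section Symmetric

variable {C : Type u} [Category.{v} C] [MonoidalCategory C] [SymmetricCategory C]

/-- The comonad comultiplication `δ : !A ⟶ !!A`. -/
abbrev dig (Q : CoalgebraModality C) (A : C) : Q.obj A ⟶ Q.obj (Q.obj A) := Q.δ.app A

/-- The comonad counit `ε : !A ⟶ A`. -/
abbrev der (Q : CoalgebraModality C) (A : C) : Q.obj A ⟶ A := Q.ε.app A

/-- The comultiplication `Δ : !A ⟶ !A ⊗ !A`. -/
abbrev comul (Q : CoalgebraModality C) (A : C) : Q.obj A ⟶ Q.obj A ⊗ Q.obj A :=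
  (Q.comon A).comul

/-- The counit `e : !A ⟶ K`. -/
abbrev counit (Q : CoalgebraModality C) (A : C) : Q.obj A ⟶ 𝟙_ C := (Q.comon A).counit

/-- The map `ε ⊗ e : !A ⊗ !B ⟶ A`. -/
def derCounit (Q : CoalgebraModality C) (A B : C) : Q.obj A ⊗ Q.obj B ⟶ A :=
  (Q.der A ⊗ₘ Q.counit B) ≫ (ρ_ A).hom

/-- The map `e ⊗ ε : !A ⊗ !B ⟶ B`. -/
def counitDer (Q : CoalgebraModality C) (A B : C) : Q.obj A ⊗ Q.obj B ⟶ B :=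
  (Q.counit A ⊗ₘ Q.der B) ≫ (λ_ B).hom

/-- The data that turn a coalgebra modality into a monoidal coalgebra modality: `!` is a
symmetric lax monoidal functor with `m_⊗ = μ` and `m_K = ε`, the transformations `δ` and `ε` of
the comonad are monoidal, `Δ` and `e` are monoidal (the first four of the other axioms), and
`Δ` and `e` are `!`-coalgebra morphisms (the last two). A symmetric monoidal category with a
monoidal coalgebra modality is a linear category. -/
structure MonoidalStructure (Q : CoalgebraModality C) where
  lax : Q.toFunctor.LaxBraided
  dig_monoidal : NatTrans.IsMonoidal Q.δ
  der_monoidal : NatTrans.IsMonoidal Q.ε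
  tensor_comul : ∀ A B : C,
    Functor.LaxMonoidal.μ Q.toFunctor A B ≫ Q.comul (A ⊗ B) =
      (Q.comul A ⊗ₘ Q.comul B) ≫ tensorμ (Q.obj A) (Q.obj A) (Q.obj B) (Q.obj B) ≫
        (Functor.LaxMonoidal.μ Q.toFunctor A B ⊗ₘ Functor.LaxMonoidal.μ Q.toFunctor A B)
  tensor_counit : ∀ A B : C,
    Functor.LaxMonoidal.μ Q.toFunctor A B ≫ Q.counit (A ⊗ B) =
      (Q.counit A ⊗ₘ Q.counit B) ≫ (λ_ (𝟙_ C)).hom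
  unit_comul : Functor.LaxMonoidal.ε Q.toFunctor ≫ Q.comul (𝟙_ C) =
    (λ_ (𝟙_ C)).inv ≫ (Functor.LaxMonoidal.ε Q.toFunctor ⊗ₘ Functor.LaxMonoidal.ε Q.toFunctor)
  unit_counit : Functor.LaxMonoidal.ε Q.toFunctor ≫ Q.counit (𝟙_ C) = 𝟙 (𝟙_ C)
  comul_coalgebra : ∀ A : C, Q.dig A ≫ Q.map (Q.comul A) =
    Q.comul A ≫ (Q.dig A ⊗ₘ Q.dig A) ≫ Functor.LaxMonoidal.μ Q.toFunctor (Q.obj A) (Q.obj A)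
  counit_coalgebra : ∀ A : C, Q.dig A ≫ Q.map (Q.counit A) =
    Q.counit A ≫ Functor.LaxMonoidal.ε Q.toFunctor

/-- The map `m_⊗ : !A ⊗ !B ⟶ !(A ⊗ B)`. -/
def MonoidalStructure.mTensor {Q : CoalgebraModality C} (M : Q.MonoidalStructure) (A B : C) :
    Q.obj A ⊗ Q.obj B ⟶ Q.obj (A ⊗ B) :=
  M.lax.toLaxMonoidal.μ A B

/-- The map `m_K : K ⟶ !K`. -/
def MonoidalStructure.mUnit {Q : CoalgebraModality C} (M : Q.MonoidalStructure) :
    𝟙_ C ⟶ Q.obj (𝟙_ C) :=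
  M.lax.toLaxMonoidal.ε

/-- The Seely map `χ = Δ ≫ (!π₀ ⊗ !π₁) : !(A × B) ⟶ !A ⊗ !B` of a product cone. -/
def seelyMap (Q : CoalgebraModality C) {A B : C} (c : BinaryFan A B) :
    Q.obj c.pt ⟶ Q.obj A ⊗ Q.obj B :=
  Q.comul c.pt ≫ (Q.map c.fst ⊗ₘ Q.map c.snd)

/-- The Seely map `χ_T = e : !T ⟶ K`. -/
def seelyMapTerminal (Q : CoalgebraModality C) (T : C) : Q.obj T ⟶ 𝟙_ C := Q.counit T

/-- `C` together with the coalgebra modality `Q` is a monoidal storage category: `C` has finite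
products and `Q` has Seely isomorphisms. Invertibility of the Seely maps does not depend on the
choice of the products, and is stated for all choices. -/
structure IsMonoidalStorage (Q : CoalgebraModality C) : Prop where
  hasFiniteProducts : HasFiniteProducts C
  isIso_seelyMap : ∀ {A B : C} (c : BinaryFan A B), IsLimit c → IsIso (Q.seelyMap c)
  isIso_seelyMapTerminal : ∀ {T : C}, IsTerminal T → IsIso (Q.seelyMapTerminal T)

/-- The Seely isomorphism `!(A × B) ≅ !A ⊗ !B`. -/
noncomputable def IsMonoidalStorage.seelyIso {Q : CoalgebraModality C}
    (S : Q.IsMonoidalStorage) {A B : C} (c : BinaryFan A B) (hc : IsLimit c) :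
    Q.obj c.pt ≅ Q.obj A ⊗ Q.obj B :=
  @asIso _ _ _ _ (Q.seelyMap c) (S.isIso_seelyMap c hc)

/-- The Seely isomorphism `!T ≅ K`. -/
noncomputable def IsMonoidalStorage.seelyIsoTerminal {Q : CoalgebraModality C}
    (S : Q.IsMonoidalStorage) {T : C} (hT : IsTerminal T) : Q.obj T ≅ 𝟙_ C :=
  @asIso _ _ _ _ (Q.seelyMapTerminal T) (S.isIso_seelyMapTerminal hT)

end Symmetric

section Additive

variable {C : Type u} [Category.{v} C] [MonoidalCategory C] [SymmetricCategory C]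
  [CMonCategory C]

/-- The data that turn a coalgebra modality into a bialgebra modality: natural commutative
monoid structures `(∇, u)` on the objects `!A` which form a bialgebra with `(Δ, e)` and are
compatible with `ε`. -/
structure BialgebraStructure (Q : CoalgebraModality C) where
  mon : ∀ A : C, MonObj (Q.obj A)
  comm : ∀ A : C, IsCommMonObj (Q.obj A)
  map_isMonHom : ∀ {A B : C} (f : A ⟶ B), IsMonHom (Q.map f)
  mul_comul : ∀ A : C, (mon A).mul ≫ Q.comul A =
    (Q.comul A ⊗ₘ Q.comul A) ≫ tensorμ (Q.obj A) (Q.obj A) (Q.obj A) (Q.obj A) ≫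
      ((mon A).mul ⊗ₘ (mon A).mul)
  one_comul : ∀ A : C, (mon A).one ≫ Q.comul A =
    (λ_ (𝟙_ C)).inv ≫ ((mon A).one ⊗ₘ (mon A).one)
  mul_counit : ∀ A : C, (mon A).mul ≫ Q.counit A =
    (Q.counit A ⊗ₘ Q.counit A) ≫ (λ_ (𝟙_ C)).hom
  one_counit : ∀ A : C, (mon A).one ≫ Q.counit A = 𝟙 (𝟙_ C)
  mul_der : ∀ A : C, (mon A).mul ≫ Q.der A = Q.derCounit A A + Q.counitDer A A

/-- The multiplication `∇ : !A ⊗ !A ⟶ !A`. -/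
abbrev BialgebraStructure.mul {Q : CoalgebraModality C} (M : Q.BialgebraStructure) (A : C) :
    Q.obj A ⊗ Q.obj A ⟶ Q.obj A := (M.mon A).mul

/-- The unit `u : K ⟶ !A`. -/
abbrev BialgebraStructure.one {Q : CoalgebraModality C} (M : Q.BialgebraStructure) (A : C) :
    𝟙_ C ⟶ Q.obj A := (M.mon A).one

/-- The data that turn a coalgebra modality into an additive bialgebra modality. -/
structure AdditiveBialgebraStructure (Q : CoalgebraModality C) extends
    Q.BialgebraStructure where
  map_add : ∀ {A B : C} (f g : A ⟶ B),
    Q.map (f + g) = Q.comul A ≫ (Q.map f ⊗ₘ Q.map g) ≫ (mon B).mul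
  map_zero : ∀ A B : C, Q.map (0 : A ⟶ B) = Q.counit A ≫ (mon B).one

/-- On an additive symmetric monoidal category: the structure of an additive linear category
with finite biproducts whose coalgebra modality is `Q`. -/
structure LinearWithBiproducts (Q : CoalgebraModality C) extends Q.MonoidalStructure where
  hasFiniteBiproducts : HasFiniteBiproducts C

/-- On an additive symmetric monoidal category: finite biproducts and the structure of an
additive bialgebra modality whose coalgebra modality is `Q`. -/
structure BialgebraWithBiproducts (Q : CoalgebraModality C) extends
    Q.AdditiveBialgebraStructure where
  hasFiniteBiproducts : HasFiniteBiproducts C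

end Additive

end CoalgebraModality

/-! Having Seely isomorphisms is a property of a coalgebra modality, and it leaves no freedom in the
other two structures: χ;m_⊗ = δ;!(χ);!(ε⊗ε) in any monoidal structure, and χ;∇ = !(codiagonal) in
any additive bialgebra structure on biproducts, with similar equations for m_K and u. As χ is epi,
structures (2) and (3) are unique when they exist, so the bijections reduce to the implications (1)
⇒ (2) ⇒ (3) ⇒ (1). Finite products are biproducts because homs can be added.

For (1) ⇒ (2), the main tool is `IsCoalgHom.hom_ext`: coalgebra morphisms into a cofree !A agree
once they agree after ε. The coherence laws of m_⊗ become trivial after ε, provided the coherence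
isomorphisms are coalgebra morphisms for the coaction (δ⊗δ);m_⊗. This is inherited along χ from
cofree coalgebras on products (`IsCoalgHom.of_epi_comp`).

For (2) ⇒ (1), Δ being a coalgebra morphism gives χ;(δ⊗δ);m_⊗ = δ;!(χ), which yields one composite
(`pairing_inv`). The other (`inv_pairing`) holds because (δ⊗δ);m_⊗ is a comonoid morphism. For (2) ⇒
(3), ∇ is the coalgebra morphism lying over ε⊗e + e⊗ε, so the monoid laws are again checked after ε.
For (3) ⇒ (1), !(f+g) = Δ;(!f⊗!g);∇ applied to the decomposition of the identity of A×B gives one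
composite (`pairing_mul`), and the bialgebra law gives the other (`mul_pairing`). -/

/-! ### Cocommutative comonoids and the middle exchange -/

section Coherence

variable {C : Type u} [Category.{v} C] [MonoidalCategory C]

section Braided
variable [BraidedCategory C]

/-- A cocommutative comultiplication is unchanged by exchanging the two middle copies. -/
theorem comul_tensor_comul_tensorμ (X : C) [ComonObj X] [IsCommComonObj X] :
    ComonObj.comul (X := X) ≫ (ComonObj.comul (X := X) ⊗ₘ ComonObj.comul (X := X)) ≫
      tensorμ X X X X = ComonObj.comul (X := X) ≫
        (ComonObj.comul (X := X) ⊗ₘ ComonObj.comul (X := X)) := by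
  -- Coassociativity makes the two middle copies arise from a single Δ, which then absorbs the
  -- braiding contained in `tensorμ`.
  have key : ComonObj.comul (X := X) ≫ (ComonObj.comul (X := X) ⊗ₘ ComonObj.comul (X := X)) =
      ComonObj.comul (X := X) ≫ X ◁ ComonObj.comul (X := X) ≫
        X ◁ (ComonObj.comul (X := X) ▷ X) ≫ X ◁ (α_ X X X).hom ≫ (α_ X X (X ⊗ X)).inv := by
    rw [MonoidalCategory.tensorHom_def, ComonObj.comul_assoc_flip_assoc]
    have h := congrArg (fun f => X ◁ f ≫ (α_ X X (X ⊗ X)).inv) (ComonObj.comul_assoc X)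
    simp only [whiskerLeft_comp, Category.assoc] at h
    rw [← h, tensor_whiskerLeft, Iso.inv_hom_id_assoc]
  rw [reassoc_of% key, key]
  simp only [tensorμ, Iso.inv_hom_id_assoc, whiskerLeft_hom_inv_assoc]
  simp only [← whiskerLeft_comp_assoc]
  rw [← comp_whiskerRight_assoc, IsCommComonObj.comul_comm]

theorem tensorμ_unit_unit (A B : C) :
    ((ρ_ A).inv ⊗ₘ (λ_ B).inv) ≫ tensorμ A (𝟙_ C) (𝟙_ C) B ≫ ((ρ_ A).hom ⊗ₘ (λ_ B).hom) =
      𝟙 (A ⊗ B) := by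
  simp only [tensorμ, braiding_tensorUnit_left, Category.assoc]
  monoidal

/-- The two middle counits cancel the two comultiplications. -/
theorem comul_tensor_comul_counit (A B : C) [ComonObj A] [ComonObj B] :
    (ComonObj.comul (X := A) ⊗ₘ ComonObj.comul (X := B)) ≫ tensorμ A A B B ≫
      ((𝟙 A ⊗ₘ ComonObj.counit (X := B)) ≫ (ρ_ A).hom ⊗ₘ
        (ComonObj.counit (X := A) ⊗ₘ 𝟙 B) ≫ (λ_ B).hom) = 𝟙 (A ⊗ B) := by
  rw [← tensorHom_comp_tensorHom, ← tensorμ_natural_assoc, tensorHom_comp_tensorHom_assoc]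
  simp [tensorμ_unit_unit]

end Braided
end Coherence

/-! ### Sums of morphisms, and finite products as biproducts -/

namespace CMonCategory

variable {C : Type u} [Category.{v} C] [CMonCategory C]

/-- Postcomposition as a homomorphism of monoids. -/
def rightComp (X : C) {Y Z : C} (h : Y ⟶ Z) : (X ⟶ Y) →+ (X ⟶ Z) where
  toFun f := f ≫ h
  map_zero' := zero_comp X h
  map_add' f g := add_comp f g h

/-- Precomposition as a homomorphism of monoids. -/
def leftComp {X Y : C} (k : X ⟶ Y) (Z : C) : (Y ⟶ Z) →+ (X ⟶ Z) where
  toFun f := k ≫ f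
  map_zero' := comp_zero k Z
  map_add' f g := comp_add k f g

theorem sum_comp {J : Type*} (s : Finset J) {X Y Z : C} (f : J → (X ⟶ Y)) (h : Y ⟶ Z) :
    (∑ j ∈ s, f j) ≫ h = ∑ j ∈ s, f j ≫ h :=
  map_sum (rightComp X h) f s

theorem comp_sum {J : Type*} (s : Finset J) {X Y Z : C} (k : X ⟶ Y) (f : J → (Y ⟶ Z)) :
    k ≫ (∑ j ∈ s, f j) = ∑ j ∈ s, k ≫ f j :=
  map_sum (leftComp k Z) f s

/-- The injections are the Kronecker deltas into the product. The projections show that ∑ π_j;ι_j is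
the identity, which forces any map out of the product to be ∑ π_j;t_j. -/
theorem hasBiproduct_of_hasProduct {J : Type} [Fintype J] (f : J → C) [HasProduct f] :
    HasBiproduct f := by
  classical
  let ι' : ∀ j, f j ⟶ ∏ᶜ f := fun j =>
    Pi.lift fun k => if h : j = k then eqToHom (congrArg f h) else (0 : f j ⟶ f k)
  have hι : ∀ j k, ι' j ≫ Pi.π f k =
      if h : j = k then eqToHom (congrArg f h) else (0 : f j ⟶ f k) := fun j k => by
    simp [ι']
  have total : ∑ j : J, Pi.π f j ≫ ι' j = 𝟙 (∏ᶜ f) := by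
    refine Pi.hom_ext _ _ fun k => ?_
    rw [sum_comp, Finset.sum_eq_single k]
    · simp [hι]
    · intro j _ hj
      rw [Category.assoc, hι, dif_neg hj, comp_zero]
    · simp
  have fac : ∀ {W : C} (t : ∀ k, f k ⟶ W) (j : J), ι' j ≫ (∑ k : J, Pi.π f k ≫ t k) = t j := by
    intro W t j
    rw [comp_sum, Finset.sum_eq_single j]
    · rw [← Category.assoc, hι]
      simp
    · intro k _ hk
      rw [← Category.assoc, hι, dif_neg (Ne.symm hk), zero_comp]
    · simp
  let b : Bicone f :=
    { pt := ∏ᶜ f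
      π := Pi.π f
      ι := ι'
      ι_π := hι }
  refine HasBiproduct.mk ⟨b, ?_, ?_⟩
  · exact (productIsProduct f).ofIsoLimit (Cone.ext (Iso.refl _) (by
      rintro ⟨j⟩
      simp [b]))
  · refine
      { desc := fun s => ∑ j : J, Pi.π f j ≫ s.ι.app ⟨j⟩
        fac := ?_
        uniq := ?_ }
    · rintro s ⟨j⟩
      exact fac (fun k => s.ι.app ⟨k⟩) j
    · intro s m hm
      change (∏ᶜ f) ⟶ _ at m
      rw [← Category.id_comp m, ← total, sum_comp]
      refine Finset.sum_congr rfl fun j _ => ?_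
      rw [Category.assoc]
      exact congrArg _ (hm ⟨j⟩)

theorem hasFiniteBiproducts_of_hasFiniteProducts [HasFiniteProducts C] :
    HasFiniteBiproducts C :=
  ⟨fun _ => ⟨fun f => hasBiproduct_of_hasProduct f⟩⟩

/-- Only joint monicity of p and q matters, so this serves bilimit bicones as well as plain product
cones with injections ⟨1,0⟩ and ⟨0,1⟩. -/
theorem total_of_hom_ext {P A B : C} {p : P ⟶ A} {q : P ⟶ B} {i : A ⟶ P} {j : B ⟶ P}
    (hip : i ≫ p = 𝟙 A) (hiq : i ≫ q = 0) (hjp : j ≫ p = 0) (hjq : j ≫ q = 𝟙 B)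
    (hom_ext : ∀ {X : C} (f g : X ⟶ P), f ≫ p = g ≫ p → f ≫ q = g ≫ q → f = g) :
    p ≫ i + q ≫ j = 𝟙 P := by
  apply hom_ext
  · rw [add_comp, Category.assoc, Category.assoc, hip, hjp, comp_zero, add_zero,
      Category.comp_id, Category.id_comp]
  · rw [add_comp, Category.assoc, Category.assoc, hiq, hjq, comp_zero, zero_add,
      Category.comp_id, Category.id_comp]

/-- The projections and injections of a binary bilimit add up to the identity. -/
theorem binaryBicone_total {A B : C} {b : BinaryBicone A B} (hb : b.IsBilimit) :
    b.fst ≫ b.inl + b.snd ≫ b.inr = 𝟙 b.pt :=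
  total_of_hom_ext b.inl_fst b.inl_snd b.inr_fst b.inr_snd
    fun _ _ h₁ h₂ => BinaryFan.IsLimit.hom_ext hb.isLimit h₁ h₂

end CMonCategory

/-! ### Basic equations of a coalgebra modality -/

namespace CoalgebraModality
variable {C : Type u} [Category.{v} C] [MonoidalCategory C] [SymmetricCategory C]
  (Q : CoalgebraModality C)

theorem map_dig {A B : C} (f : A ⟶ B) : Q.map f ≫ Q.dig B = Q.dig A ≫ Q.map (Q.map f) :=
  Q.δ.naturality f

theorem map_der {A B : C} (f : A ⟶ B) : Q.map f ≫ Q.der B = Q.der A ≫ f :=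
  Q.ε.naturality f

theorem map_comul {A B : C} (f : A ⟶ B) :
    Q.map f ≫ Q.comul B = Q.comul A ≫ (Q.map f ⊗ₘ Q.map f) :=
  (Q.map_isComonHom f).hom_comul

theorem map_counit {A B : C} (f : A ⟶ B) : Q.map f ≫ Q.counit B = Q.counit A :=
  (Q.map_isComonHom f).hom_counit

theorem dig_der (A : C) : Q.dig A ≫ Q.der (Q.obj A) = 𝟙 (Q.obj A) :=
  Q.left_counit A

theorem dig_map_der (A : C) : Q.dig A ≫ Q.map (Q.der A) = 𝟙 (Q.obj A) :=
  Q.right_counit A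

theorem dig_dig (A : C) : Q.dig A ≫ Q.dig (Q.obj A) = Q.dig A ≫ Q.map (Q.dig A) :=
  (Q.coassoc A).symm

theorem dig_comul (A : C) :
    Q.dig A ≫ Q.comul (Q.obj A) = Q.comul A ≫ (Q.dig A ⊗ₘ Q.dig A) :=
  Q.δ_comul A

/-- The axioms only ask δ to preserve Δ; preservation of e follows from naturality of e along ε and
δ;!(ε) = 1. -/
theorem dig_counit (A : C) : Q.dig A ≫ Q.counit (Q.obj A) = Q.counit A := by
  rw [← Q.map_counit (Q.der A), reassoc_of% (Q.dig_map_der A)]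

theorem comul_braiding (A : C) : Q.comul A ≫ (β_ (Q.obj A) (Q.obj A)).hom = Q.comul A :=
  let _ := Q.comon A
  (Q.comm A).comul_comm

theorem comul_counit_hom (A : C) {Z : C} (f : Q.obj A ⟶ Z) :
    Q.comul A ≫ (f ⊗ₘ Q.counit A) = f ≫ (ρ_ Z).inv :=
  let _ := Q.comon A
  ComonObj.comul_counit_hom f

theorem counit_comul_hom (A : C) {Z : C} (f : Q.obj A ⟶ Z) :
    Q.comul A ≫ (Q.counit A ⊗ₘ f) = f ≫ (λ_ Z).inv :=
  let _ := Q.comon A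
  ComonObj.counit_comul_hom f

theorem comul_assoc (A : C) :
    Q.comul A ≫ (Q.comul A ⊗ₘ 𝟙 (Q.obj A)) ≫ (α_ _ _ _).hom =
      Q.comul A ≫ (𝟙 (Q.obj A) ⊗ₘ Q.comul A) := by
  let _ := Q.comon A
  have := ComonObj.comul_assoc (Q.obj A)
  rw [tensorHom_id, id_tensorHom]
  exact this.symm

theorem comul_interchange (A : C) :
    Q.comul A ≫ (Q.comul A ⊗ₘ Q.comul A) ≫ tensorμ _ _ _ _ =
      Q.comul A ≫ (Q.comul A ⊗ₘ Q.comul A) :=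
  let _ := Q.comon A
  let _ := Q.comm A
  comul_tensor_comul_tensorμ (Q.obj A)

theorem comul_tensor_comul_counit (A B : C) :
    (Q.comul A ⊗ₘ Q.comul B) ≫ tensorμ _ _ _ _ ≫
      ((𝟙 _ ⊗ₘ Q.counit B) ≫ (ρ_ _).hom ⊗ₘ (Q.counit A ⊗ₘ 𝟙 _) ≫ (λ_ _).hom) =
      𝟙 (Q.obj A ⊗ Q.obj B) :=
  let _ := Q.comon A
  let _ := Q.comon B
  _root_.comul_tensor_comul_counit (Q.obj A) (Q.obj B)

theorem comul_derCounit (A : C) : Q.comul A ≫ Q.derCounit A A = Q.der A := by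
  rw [derCounit, reassoc_of% (Q.comul_counit_hom A (Q.der A))]
  simp

theorem comul_counitDer (A : C) : Q.comul A ≫ Q.counitDer A A = Q.der A := by
  rw [counitDer, reassoc_of% (Q.counit_comul_hom A (Q.der A))]
  simp

theorem map_tensor_derCounit {A A' B B' : C} (f : A ⟶ A') (g : B ⟶ B') :
    (Q.map f ⊗ₘ Q.map g) ≫ Q.derCounit A' B' = Q.derCounit A B ≫ f := by
  simp only [derCounit, tensorHom_comp_tensorHom_assoc, map_der, map_counit, Category.assoc]
  rw [← rightUnitor_naturality, ← tensorHom_id, tensorHom_comp_tensorHom_assoc, Category.comp_id]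

theorem map_tensor_counitDer {A A' B B' : C} (f : A ⟶ A') (g : B ⟶ B') :
    (Q.map f ⊗ₘ Q.map g) ≫ Q.counitDer A' B' = Q.counitDer A B ≫ g := by
  simp only [counitDer, tensorHom_comp_tensorHom_assoc, map_der, map_counit, Category.assoc]
  rw [← leftUnitor_naturality, ← id_tensorHom, tensorHom_comp_tensorHom_assoc, Category.comp_id]

end CoalgebraModality

/-! ### Coalgebra morphisms and their tensor products -/

namespace CoalgebraModality
variable {C : Type u} [Category.{v} C] [MonoidalCategory C] [SymmetricCategory C]
  (Q : CoalgebraModality C)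

/-- `f` commutes with the coactions `x` and `y` of the comonad. -/
def IsCoalgHom {X Y : C} (x : X ⟶ Q.obj X) (y : Y ⟶ Q.obj Y) (f : X ⟶ Y) : Prop :=
  f ≫ y = x ≫ Q.map f

variable {Q}

theorem IsCoalgHom.comp {X Y Z : C} {x : X ⟶ Q.obj X} {y : Y ⟶ Q.obj Y} {z : Z ⟶ Q.obj Z}
    {f : X ⟶ Y} {g : Y ⟶ Z} (hf : Q.IsCoalgHom x y f) (hg : Q.IsCoalgHom y z g) :
    Q.IsCoalgHom x z (f ≫ g) := by
  unfold IsCoalgHom at *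
  rw [Category.assoc, hg, reassoc_of% hf, Q.map_comp]

theorem IsCoalgHom.id {X : C} (x : X ⟶ Q.obj X) : Q.IsCoalgHom x x (𝟙 X) := by
  simp [IsCoalgHom]

theorem IsCoalgHom.of_epi_comp {X Y Z : C} {x : X ⟶ Q.obj X} {y : Y ⟶ Q.obj Y}
    {z : Z ⟶ Q.obj Z} {f : X ⟶ Y} {g : Y ⟶ Z} [Epi f] (hf : Q.IsCoalgHom x y f)
    (hfg : Q.IsCoalgHom x z (f ≫ g)) : Q.IsCoalgHom y z g := by
  unfold IsCoalgHom at *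
  rw [← cancel_epi f, ← Category.assoc, hfg, reassoc_of% hf, Q.map_comp]

theorem IsCoalgHom.map {A B : C} (f : A ⟶ B) :
    Q.IsCoalgHom (Q.dig A) (Q.dig B) (Q.map f) :=
  Q.map_dig f

theorem IsCoalgHom.dig (A : C) : Q.IsCoalgHom (Q.dig A) (Q.dig (Q.obj A)) (Q.dig A) :=
  Q.dig_dig A

/-- Morphisms into a cofree coalgebra are determined by their composite with `ε`. -/
theorem IsCoalgHom.hom_ext {X A : C} {x : X ⟶ Q.obj X} {f g : X ⟶ Q.obj A}
    (hf : Q.IsCoalgHom x (Q.dig A) f) (hg : Q.IsCoalgHom x (Q.dig A) g)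
    (h : f ≫ Q.der A = g ≫ Q.der A) : f = g := by
  -- Only the law δ;!(ε) = 1 of the target is needed, so x may be any map X ⟶ !X; no coalgebra
  -- axioms for it have to be proved.
  have key : ∀ {k : X ⟶ Q.obj A}, Q.IsCoalgHom x (Q.dig A) k → k = x ≫ Q.map (k ≫ Q.der A) := by
    intro k hk
    unfold IsCoalgHom at hk
    rw [Q.map_comp, ← reassoc_of% hk, Q.dig_map_der, Category.comp_id]
  rw [key hf, key hg, h]

variable (Q) in
/-- A binary tensor operation for coalgebras of the comonad. -/
structure Tensorator where
  hom : ∀ A B : C, Q.obj A ⊗ Q.obj B ⟶ Q.obj (A ⊗ B)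
  natural : ∀ {A A' B B' : C} (f : A ⟶ A') (g : B ⟶ B'),
    (Q.map f ⊗ₘ Q.map g) ≫ hom A' B' = hom A B ≫ Q.map (f ⊗ₘ g)
  hom_der : ∀ A B : C, hom A B ≫ Q.der (A ⊗ B) = Q.der A ⊗ₘ Q.der B
  hom_dig : ∀ A B : C, hom A B ≫ Q.dig (A ⊗ B) =
    (Q.dig A ⊗ₘ Q.dig B) ≫ hom (Q.obj A) (Q.obj B) ≫ Q.map (hom A B)

namespace Tensorator
variable (T : Q.Tensorator)

/-- The tensor product of two coactions. -/
def coact {X Y : C} (x : X ⟶ Q.obj X) (y : Y ⟶ Q.obj Y) : X ⊗ Y ⟶ Q.obj (X ⊗ Y) :=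
  (x ⊗ₘ y) ≫ T.hom X Y

theorem isCoalgHom_tensor {X X' Y Y' : C} {x : X ⟶ Q.obj X} {x' : X' ⟶ Q.obj X'}
    {y : Y ⟶ Q.obj Y} {y' : Y' ⟶ Q.obj Y'} {f : X ⟶ X'} {g : Y ⟶ Y'}
    (hf : Q.IsCoalgHom x x' f) (hg : Q.IsCoalgHom y y' g) :
    Q.IsCoalgHom (T.coact x y) (T.coact x' y') (f ⊗ₘ g) := by
  unfold IsCoalgHom coact at *
  rw [tensorHom_comp_tensorHom_assoc, hf, hg, ← tensorHom_comp_tensorHom_assoc, T.natural,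
    Category.assoc]

theorem isCoalgHom_hom (A B : C) :
    Q.IsCoalgHom (T.coact (Q.dig A) (Q.dig B)) (Q.dig (A ⊗ B)) (T.hom A B) := by
  unfold IsCoalgHom coact
  rw [T.hom_dig, Category.assoc]

end Tensorator

/-! ### From Seely isomorphisms to a monoidal structure -/

section Terminal
variable [HasTerminal C] [IsIso (Q.counit (⊤_ C))]

variable (Q) in
/-- The unit `m_K` that is induced by the Seely isomorphisms. -/
noncomputable def seelyUnit : 𝟙_ C ⟶ Q.obj (𝟙_ C) :=
  inv (Q.counit (⊤_ C)) ≫ Q.dig _ ≫ Q.map (Q.counit _)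

/-- Naturality of e along A ⟶ T reduces this to T. Since e is epi at T, the laws of m_K below are
checked after precomposition with e, by this equation. -/
theorem counit_seelyUnit (A : C) :
    Q.counit A ≫ Q.seelyUnit = Q.dig A ≫ Q.map (Q.counit A) := by
  rw [← Q.map_counit (terminal.from A), seelyUnit]
  simp [reassoc_of% Q.map_dig]

theorem isCoalgHom_counit (A : C) : Q.IsCoalgHom (Q.dig A) Q.seelyUnit (Q.counit A) :=
  counit_seelyUnit A

theorem seelyUnit_der : Q.seelyUnit ≫ Q.der _ = 𝟙 _ := by
  rw [← cancel_epi (Q.counit (⊤_ C)), reassoc_of% counit_seelyUnit, Q.map_der,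
    reassoc_of% Q.dig_der, Category.comp_id]

theorem seelyUnit_dig : Q.seelyUnit ≫ Q.dig _ = Q.seelyUnit ≫ Q.map Q.seelyUnit := by
  rw [← cancel_epi (Q.counit (⊤_ C)), reassoc_of% counit_seelyUnit, Q.map_dig,
    reassoc_of% Q.dig_dig, reassoc_of% counit_seelyUnit, ← Q.map_comp, ← Q.map_comp,
    counit_seelyUnit]

theorem seelyUnit_comul : Q.seelyUnit ≫ Q.comul _ =
    (λ_ (𝟙_ C)).inv ≫ (Q.seelyUnit ⊗ₘ Q.seelyUnit) := by
  rw [← cancel_epi (Q.counit (⊤_ C)), reassoc_of% counit_seelyUnit, Q.map_comul,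
    reassoc_of% Q.dig_comul, tensorHom_comp_tensorHom, ← counit_seelyUnit,
    ← reassoc_of% (Q.counit_comul_hom _ (Q.counit _)), tensorHom_comp_tensorHom]

theorem seelyUnit_counit : Q.seelyUnit ≫ Q.counit _ = 𝟙 _ := by
  rw [← cancel_epi (Q.counit (⊤_ C)), reassoc_of% counit_seelyUnit, Q.map_counit,
    Q.dig_counit, Category.comp_id]

end Terminal

section Products

variable [HasBinaryProducts C]

variable (Q) in
/-- The Seely map of the chosen binary products. -/
noncomputable def prodSeely (A B : C) : Q.obj (A ⨯ B) ⟶ Q.obj A ⊗ Q.obj B :=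
  Q.comul (A ⨯ B) ≫ (Q.map prod.fst ⊗ₘ Q.map prod.snd)

/-- Naturality of χ only covers maps !f, but δ must be treated too. A coalgebra morphism f equals
δ;!(f;ε), so the lift is the coalgebra morphism over ⟨!π₀;f;ε, !π₁;g;ε⟩. -/
theorem prodSeely_factor {A A' B B' : C} {f : Q.obj A ⟶ Q.obj A'} {g : Q.obj B ⟶ Q.obj B'}
    (hf : Q.IsCoalgHom (Q.dig A) (Q.dig A') f) (hg : Q.IsCoalgHom (Q.dig B) (Q.dig B') g) :
    ∃ h : Q.obj (A ⨯ B) ⟶ Q.obj (A' ⨯ B'), Q.IsCoalgHom (Q.dig _) (Q.dig _) h ∧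
      Q.prodSeely A B ≫ (f ⊗ₘ g) = h ≫ Q.prodSeely A' B' := by
  unfold IsCoalgHom at hf hg
  refine ⟨Q.dig _ ≫ Q.map (prod.lift (Q.map prod.fst ≫ f ≫ Q.der A')
    (Q.map prod.snd ≫ g ≫ Q.der B')), (IsCoalgHom.dig _).comp (IsCoalgHom.map _), ?_⟩
  simp only [prodSeely, Category.assoc, reassoc_of% Q.map_comul, reassoc_of% Q.dig_comul,
    tensorHom_comp_tensorHom, ← Q.map_comp, prod.lift_fst, prod.lift_snd]
  simp only [Q.map_comp, ← reassoc_of% Q.map_dig, ← reassoc_of% hf, ← reassoc_of% hg,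
    Q.dig_map_der, Category.comp_id]

theorem prodSeely_associator (A B D : C) :
    Q.prodSeely (A ⨯ B) D ≫ (Q.prodSeely A B ⊗ₘ 𝟙 _) ≫ (α_ _ _ _).hom =
      Q.map (prod.associator A B D).hom ≫ Q.prodSeely A (B ⨯ D) ≫
        (𝟙 _ ⊗ₘ Q.prodSeely B D) := by
  have h := Q.comul_assoc ((A ⨯ B) ⨯ D) =≫ (Q.map (prod.fst ≫ prod.fst) ⊗ₘ
    (Q.map (prod.fst ≫ prod.snd) ⊗ₘ Q.map prod.snd))
  simp only [Category.assoc, ← associator_naturality, tensorHom_comp_tensorHom,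
    tensorHom_comp_tensorHom_assoc] at h
  simp only [prodSeely, Category.assoc, reassoc_of% Q.map_comul, tensorHom_comp_tensorHom,
    tensorHom_comp_tensorHom_assoc, ← Q.map_comp, prod.associator_hom,
    prod.lift_fst, prod.lift_snd, Category.comp_id, Category.id_comp, prod.lift_snd_assoc] at h ⊢
  exact h

theorem prodSeely_braiding (A B : C) :
    Q.prodSeely A B ≫ (β_ _ _).hom = Q.map (prod.braiding A B).hom ≫ Q.prodSeely B A := by
  simp only [prodSeely, Category.assoc, BraidedCategory.braiding_naturality,
    reassoc_of% Q.comul_braiding, reassoc_of% Q.map_comul, tensorHom_comp_tensorHom,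
    ← Q.map_comp, prod.braiding_hom, prod.lift_fst, prod.lift_snd]

theorem map_diag_prodSeely (A : C) : Q.map (diag A) ≫ Q.prodSeely A A = Q.comul A := by
  rw [prodSeely, reassoc_of% Q.map_comul, tensorHom_comp_tensorHom, ← Q.map_comp, ← Q.map_comp,
    prod.lift_fst, prod.lift_snd, Q.map_id, id_tensorHom_id, Category.comp_id]

/-- χ is a comonoid morphism because cocommutativity lets the middle copies be exchanged. -/
theorem prodSeely_comul (A B : C) :
    Q.prodSeely A B ≫ (Q.comul A ⊗ₘ Q.comul B) ≫ tensorμ _ _ _ _ =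
      Q.comul _ ≫ (Q.prodSeely A B ⊗ₘ Q.prodSeely A B) := by
  simp only [prodSeely, Category.assoc, tensorHom_comp_tensorHom_assoc, Q.map_comul]
  simp only [← tensorHom_comp_tensorHom, tensorμ_natural, Category.assoc, reassoc_of% Q.comul_interchange]

theorem prodSeely_counit (A B : C) :
    Q.prodSeely A B ≫ (Q.counit A ⊗ₘ Q.counit B) ≫ (λ_ _).hom = Q.counit _ := by
  simp only [prodSeely, Category.assoc, tensorHom_comp_tensorHom_assoc, Q.map_counit]
  rw [reassoc_of% (Q.counit_comul_hom (A ⨯ B) (Q.counit _))]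
  simp

variable [∀ A B : C, IsIso (Q.prodSeely A B)]

variable (Q) in
/-- The tensorator that is induced by the Seely isomorphisms. -/
noncomputable def seelyHom (A B : C) : Q.obj A ⊗ Q.obj B ⟶ Q.obj (A ⊗ B) :=
  inv (Q.prodSeely A B) ≫ Q.dig _ ≫ Q.map (Q.prodSeely A B) ≫ Q.map (Q.der A ⊗ₘ Q.der B)

theorem prodSeely_seelyHom (A B : C) : Q.prodSeely A B ≫ Q.seelyHom A B =
    Q.dig _ ≫ Q.map (Q.prodSeely A B ≫ (Q.der A ⊗ₘ Q.der B)) := by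
  simp [seelyHom]

/-- `χ` composed with the tensor product of two coalgebra morphisms and `m_⊗`. -/
theorem prodSeely_tensor_seelyHom {A A' B B' : C} {f : Q.obj A ⟶ Q.obj A'}
    {g : Q.obj B ⟶ Q.obj B'} (hf : Q.IsCoalgHom (Q.dig A) (Q.dig A') f)
    (hg : Q.IsCoalgHom (Q.dig B) (Q.dig B') g) :
    Q.prodSeely A B ≫ (f ⊗ₘ g) ≫ Q.seelyHom A' B' =
      Q.dig _ ≫ Q.map (Q.prodSeely A B ≫ (f ≫ Q.der A' ⊗ₘ g ≫ Q.der B')) := by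
  obtain ⟨h, hh, e⟩ := prodSeely_factor hf hg
  unfold IsCoalgHom at hh
  rw [reassoc_of% e, prodSeely_seelyHom, reassoc_of% hh, ← Q.map_comp, ← reassoc_of% e,
    tensorHom_comp_tensorHom]

theorem prodSeely_dig_seelyHom (A B : C) :
    Q.prodSeely A B ≫ (Q.dig A ⊗ₘ Q.dig B) ≫ Q.seelyHom _ _ =
      Q.dig _ ≫ Q.map (Q.prodSeely A B) := by
  rw [prodSeely_tensor_seelyHom (IsCoalgHom.dig A) (IsCoalgHom.dig B), Q.dig_der, Q.dig_der]
  simp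

variable (Q) in
/-- The Seely isomorphisms induce a tensor operation for coalgebras of the comonad. -/
noncomputable def seelyTensorator : Q.Tensorator where
  hom := Q.seelyHom
  natural f g := by
    rw [← cancel_epi (Q.prodSeely _ _), prodSeely_tensor_seelyHom (.map f) (.map g),
      reassoc_of% prodSeely_seelyHom, ← Q.map_comp, Category.assoc, tensorHom_comp_tensorHom,
      Q.map_der, Q.map_der]
  hom_der A B := by
    rw [← cancel_epi (Q.prodSeely _ _), reassoc_of% prodSeely_seelyHom, Q.map_der,
      reassoc_of% Q.dig_der]
  hom_dig A B := by
    rw [← cancel_epi (Q.prodSeely _ _), reassoc_of% prodSeely_dig_seelyHom, ← Q.map_comp,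
      reassoc_of% prodSeely_seelyHom, prodSeely_seelyHom, Q.map_dig, reassoc_of% Q.dig_dig,
      ← Q.map_comp]

theorem isCoalgHom_prodSeely (A B : C) : Q.IsCoalgHom (Q.dig (A ⨯ B))
    (Q.seelyTensorator.coact (Q.dig A) (Q.dig B)) (Q.prodSeely A B) :=
  prodSeely_dig_seelyHom A B

/-- The iterated χ is an epi coalgebra morphism from a cofree coalgebra, and it turns α into ! of
the associator of the product. -/
theorem isCoalgHom_associator (A B D : C) :
    Q.IsCoalgHom
      (Q.seelyTensorator.coact (Q.seelyTensorator.coact (Q.dig A) (Q.dig B)) (Q.dig D))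
      (Q.seelyTensorator.coact (Q.dig A) (Q.seelyTensorator.coact (Q.dig B) (Q.dig D)))
      (α_ (Q.obj A) (Q.obj B) (Q.obj D)).hom := by
  have h : Q.IsCoalgHom (Q.dig _) _ _ := (isCoalgHom_prodSeely (A ⨯ B) D).comp
    (Q.seelyTensorator.isCoalgHom_tensor (isCoalgHom_prodSeely A B) (.id (Q.dig D)))
  refine h.of_epi_comp ?_
  rw [Category.assoc, prodSeely_associator]
  exact (IsCoalgHom.map _).comp ((isCoalgHom_prodSeely A (B ⨯ D)).comp
    (Q.seelyTensorator.isCoalgHom_tensor (.id (Q.dig A)) (isCoalgHom_prodSeely B D)))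

theorem isCoalgHom_braiding (A B : C) :
    Q.IsCoalgHom (Q.seelyTensorator.coact (Q.dig A) (Q.dig B))
      (Q.seelyTensorator.coact (Q.dig B) (Q.dig A)) (β_ (Q.obj A) (Q.obj B)).hom := by
  refine (isCoalgHom_prodSeely A B).of_epi_comp ?_
  rw [prodSeely_braiding]
  exact (IsCoalgHom.map _).comp (isCoalgHom_prodSeely B A)

theorem isCoalgHom_comul (A : C) :
    Q.IsCoalgHom (Q.dig A) (Q.seelyTensorator.coact (Q.dig A) (Q.dig A)) (Q.comul A) := by
  rw [← map_diag_prodSeely]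
  exact (IsCoalgHom.map _).comp (isCoalgHom_prodSeely A A)

/-- Both sides are coalgebra morphisms into a cofree coalgebra, and after ε both become (ε⊗ε)⊗ε
followed by α. -/
theorem seelyHom_associativity (A B D : C) :
    (Q.seelyHom A B ⊗ₘ 𝟙 _) ≫ Q.seelyHom (A ⊗ B) D ≫ Q.map (α_ A B D).hom =
      (α_ _ _ _).hom ≫ (𝟙 _ ⊗ₘ Q.seelyHom B D) ≫ Q.seelyHom A (B ⊗ D) := by
  have hT := Q.seelyTensorator.isCoalgHom_hom
  have hd := Q.seelyTensorator.hom_der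
  refine IsCoalgHom.hom_ext ((Q.seelyTensorator.isCoalgHom_tensor (hT A B) (.id _)).comp
    ((hT _ _).comp (.map _))) ((isCoalgHom_associator A B D).comp
      ((Q.seelyTensorator.isCoalgHom_tensor (.id _) (hT B D)).comp (hT _ _))) ?_
  change ∀ A B, Q.seelyHom A B ≫ _ = _ at hd
  simp only [Category.assoc, Q.map_der, hd, reassoc_of% hd, tensorHom_comp_tensorHom,
    tensorHom_comp_tensorHom_assoc, Category.id_comp, associator_naturality]

theorem seelyHom_braided (A B : C) :
    Q.seelyHom A B ≫ Q.map (β_ A B).hom = (β_ _ _).hom ≫ Q.seelyHom B A := by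
  have hT := Q.seelyTensorator.isCoalgHom_hom
  have hd := Q.seelyTensorator.hom_der
  refine IsCoalgHom.hom_ext ((hT _ _).comp (.map _))
    ((isCoalgHom_braiding A B).comp (hT _ _)) ?_
  change ∀ A B, Q.seelyHom A B ≫ _ = _ at hd
  simp only [Category.assoc, Q.map_der, hd, reassoc_of% hd, BraidedCategory.braiding_naturality]

/-- The target is not of the form !X, so uniqueness into cofree coalgebras does not apply;
cancelling χ, itself a comonoid morphism, does the work. -/
theorem seelyHom_comul (A B : C) : Q.seelyHom A B ≫ Q.comul (A ⊗ B) =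
    (Q.comul A ⊗ₘ Q.comul B) ≫ tensorμ _ _ _ _ ≫ (Q.seelyHom A B ⊗ₘ Q.seelyHom A B) := by
  rw [← cancel_epi (Q.prodSeely A B), reassoc_of% prodSeely_comul, tensorHom_comp_tensorHom,
    reassoc_of% prodSeely_seelyHom, prodSeely_seelyHom, Q.map_comul, reassoc_of% Q.dig_comul,
    tensorHom_comp_tensorHom]

theorem seelyHom_counit (A B : C) : Q.seelyHom A B ≫ Q.counit (A ⊗ B) =
    (Q.counit A ⊗ₘ Q.counit B) ≫ (λ_ (𝟙_ C)).hom := by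
  rw [← cancel_epi (Q.prodSeely A B), prodSeely_counit, reassoc_of% prodSeely_seelyHom,
    Q.map_counit, Q.dig_counit]

section Terminal
variable [HasTerminal C] [IsIso (Q.counit (⊤_ C))]

theorem isCoalgHom_leftUnitor (A : C) :
    Q.IsCoalgHom (Q.seelyTensorator.coact Q.seelyUnit (Q.dig A)) (Q.dig A)
      (λ_ (Q.obj A)).hom := by
  have h : Q.IsCoalgHom (Q.dig _) _ _ := (isCoalgHom_prodSeely (⊤_ C) A).comp
    (Q.seelyTensorator.isCoalgHom_tensor (isCoalgHom_counit (⊤_ C)) (.id (Q.dig A)))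
  refine h.of_epi_comp ?_
  have : (Q.prodSeely (⊤_ C) A ≫ (Q.counit (⊤_ C) ⊗ₘ 𝟙 _)) ≫ (λ_ (Q.obj A)).hom =
      Q.map prod.snd := by
    simp only [prodSeely, Category.assoc, tensorHom_comp_tensorHom_assoc, Q.map_counit,
      Category.comp_id]
    rw [reassoc_of% (Q.counit_comul_hom _ (Q.map prod.snd)), Iso.inv_hom_id, Category.comp_id]
  rw [this]
  exact .map _

theorem isCoalgHom_rightUnitor (A : C) :
    Q.IsCoalgHom (Q.seelyTensorator.coact (Q.dig A) Q.seelyUnit) (Q.dig A)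
      (ρ_ (Q.obj A)).hom := by
  have h : Q.IsCoalgHom (Q.dig _) _ _ := (isCoalgHom_prodSeely A (⊤_ C)).comp
    (Q.seelyTensorator.isCoalgHom_tensor (.id (Q.dig A)) (isCoalgHom_counit (⊤_ C)))
  refine h.of_epi_comp ?_
  have : (Q.prodSeely A (⊤_ C) ≫ (𝟙 _ ⊗ₘ Q.counit (⊤_ C))) ≫ (ρ_ (Q.obj A)).hom =
      Q.map prod.fst := by
    simp only [prodSeely, Category.assoc, tensorHom_comp_tensorHom_assoc, Q.map_counit,
      Category.comp_id]
    rw [reassoc_of% (Q.comul_counit_hom _ (Q.map prod.fst)), Iso.inv_hom_id, Category.comp_id]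
  rw [this]
  exact .map _

theorem seelyHom_left_unitality (A : C) :
    (λ_ (Q.obj A)).hom = (Q.seelyUnit ⊗ₘ 𝟙 _) ≫ Q.seelyHom (𝟙_ C) A ≫ Q.map (λ_ A).hom := by
  have hd := Q.seelyTensorator.hom_der
  refine (isCoalgHom_leftUnitor A).hom_ext ((Q.seelyTensorator.isCoalgHom_tensor
    (seelyUnit_dig (Q := Q)) (.id _)).comp
      ((Q.seelyTensorator.isCoalgHom_hom _ _).comp (.map _))) ?_
  change ∀ A B, Q.seelyHom A B ≫ _ = _ at hd
  simp only [Category.assoc, Q.map_der, reassoc_of% hd, tensorHom_comp_tensorHom_assoc,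
    seelyUnit_der, Category.id_comp, id_tensorHom, leftUnitor_naturality]

theorem seelyHom_right_unitality (A : C) :
    (ρ_ (Q.obj A)).hom = (𝟙 _ ⊗ₘ Q.seelyUnit) ≫ Q.seelyHom A (𝟙_ C) ≫ Q.map (ρ_ A).hom := by
  have hd := Q.seelyTensorator.hom_der
  refine (isCoalgHom_rightUnitor A).hom_ext ((Q.seelyTensorator.isCoalgHom_tensor
    (.id _) (seelyUnit_dig (Q := Q))).comp
      ((Q.seelyTensorator.isCoalgHom_hom _ _).comp (.map _))) ?_
  change ∀ A B, Q.seelyHom A B ≫ _ = _ at hd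
  simp only [Category.assoc, Q.map_der, reassoc_of% hd, tensorHom_comp_tensorHom_assoc,
    seelyUnit_der, Category.id_comp, tensorHom_id, rightUnitor_naturality]

variable (Q) in
/-- The lax braided structure that is induced by the Seely isomorphisms. -/
@[reducible]
noncomputable def seelyLaxBraided : Q.toFunctor.LaxBraided where
  ε := Q.seelyUnit
  μ := Q.seelyHom
  μ_natural_left f X := by
    rw [← tensorHom_id, ← Q.map_id]
    exact (Q.seelyTensorator.natural f (𝟙 X)).trans (by rw [tensorHom_id]; rfl)
  μ_natural_right X f := by
    rw [← id_tensorHom, ← Q.map_id]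
    exact (Q.seelyTensorator.natural (𝟙 X) f).trans (by rw [id_tensorHom]; rfl)
  associativity A B D := by
    rw [← tensorHom_id, ← id_tensorHom]
    exact seelyHom_associativity A B D
  left_unitality A := by
    rw [← tensorHom_id]
    exact seelyHom_left_unitality A
  right_unitality A := by
    rw [← id_tensorHom]
    exact seelyHom_right_unitality A
  braided := seelyHom_braided

variable (Q) in
/-- The monoidal coalgebra modality that is induced by the Seely isomorphisms. -/
noncomputable def seelyMonoidalStructure : Q.MonoidalStructure :=
  letI := Q.seelyLaxBraided
  { lax := Q.seelyLaxBraided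
    dig_monoidal :=
      { unit := seelyUnit_dig
        tensor := Q.seelyTensorator.hom_dig }
    der_monoidal :=
      { unit := seelyUnit_der
        tensor := fun A B => (Q.seelyTensorator.hom_der A B).trans (Category.comp_id _).symm }
    tensor_comul := seelyHom_comul
    tensor_counit := seelyHom_counit
    unit_comul := seelyUnit_comul
    unit_counit := seelyUnit_counit
    comul_coalgebra := fun A => (isCoalgHom_comul A).symm
    counit_coalgebra := fun A => (counit_seelyUnit A).symm }

end Terminal

end Products

end CoalgebraModality

/-! ### From a monoidal structure to Seely isomorphisms -/

namespace CoalgebraModality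
variable {C : Type u} [Category.{v} C] [MonoidalCategory C] [SymmetricCategory C]
  {Q : CoalgebraModality C}

namespace MonoidalStructure
variable (M : Q.MonoidalStructure)

theorem ext {M N : Q.MonoidalStructure} (h : ∀ A B, M.mTensor A B = N.mTensor A B)
    (h' : M.mUnit = N.mUnit) : M = N := by
  obtain ⟨@⟨⟨ε₁, μ₁, _, _, _, _, _⟩, _⟩, _⟩ := M
  obtain ⟨@⟨⟨ε₂, μ₂, _, _, _, _, _⟩, _⟩, _⟩ := N
  obtain rfl : ε₁ = ε₂ := h'
  obtain rfl : μ₁ = μ₂ := funext fun A => funext fun B => h A B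
  rfl

/-- The tensor operation for coalgebras of a monoidal comonad. -/
def tensorator : Q.Tensorator where
  hom := M.mTensor
  natural f g := by
    let _ := M.lax
    exact Functor.LaxMonoidal.μ_natural Q.toFunctor f g
  hom_der A B := by
    let _ := M.lax
    exact (M.der_monoidal.tensor A B).trans (Category.comp_id _)
  hom_dig A B := by
    let _ := M.lax
    exact M.dig_monoidal.tensor A B

theorem mTensor_natural {A A' B B' : C} (f : A ⟶ A') (g : B ⟶ B') :
    (Q.map f ⊗ₘ Q.map g) ≫ M.mTensor A' B' = M.mTensor A B ≫ Q.map (f ⊗ₘ g) :=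
  M.tensorator.natural f g

theorem mTensor_der (A B : C) : M.mTensor A B ≫ Q.der (A ⊗ B) = Q.der A ⊗ₘ Q.der B :=
  M.tensorator.hom_der A B

theorem mTensor_comul (A B : C) : M.mTensor A B ≫ Q.comul (A ⊗ B) =
    (Q.comul A ⊗ₘ Q.comul B) ≫ tensorμ _ _ _ _ ≫ (M.mTensor A B ⊗ₘ M.mTensor A B) :=
  M.tensor_comul A B

theorem mTensor_counit (A B : C) : M.mTensor A B ≫ Q.counit (A ⊗ B) =
    (Q.counit A ⊗ₘ Q.counit B) ≫ (λ_ (𝟙_ C)).hom :=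
  M.tensor_counit A B

theorem mUnit_der : M.mUnit ≫ Q.der (𝟙_ C) = 𝟙 (𝟙_ C) :=
  let _ := M.lax
  M.der_monoidal.unit

theorem mUnit_dig : M.mUnit ≫ Q.dig (𝟙_ C) = M.mUnit ≫ Q.map M.mUnit :=
  let _ := M.lax
  M.dig_monoidal.unit

theorem mUnit_comul : M.mUnit ≫ Q.comul (𝟙_ C) = (λ_ (𝟙_ C)).inv ≫ (M.mUnit ⊗ₘ M.mUnit) :=
  M.unit_comul

theorem mUnit_counit : M.mUnit ≫ Q.counit (𝟙_ C) = 𝟙 (𝟙_ C) :=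
  M.unit_counit

theorem comul_mTensor (A : C) : Q.comul A ≫ (Q.dig A ⊗ₘ Q.dig A) ≫ M.mTensor _ _ =
    Q.dig A ≫ Q.map (Q.comul A) :=
  (M.comul_coalgebra A).symm

theorem counit_mUnit (A : C) : Q.counit A ≫ M.mUnit = Q.dig A ≫ Q.map (Q.counit A) :=
  (M.counit_coalgebra A).symm

theorem mTensor_associativity (A B D : C) :
    (M.mTensor A B ⊗ₘ 𝟙 _) ≫ M.mTensor (A ⊗ B) D ≫ Q.map (α_ A B D).hom =
      (α_ _ _ _).hom ≫ (𝟙 _ ⊗ₘ M.mTensor B D) ≫ M.mTensor A (B ⊗ D) := by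
  rw [tensorHom_id, id_tensorHom]
  exact M.lax.toLaxMonoidal.associativity A B D

theorem mTensor_braiding (A B : C) :
    M.mTensor A B ≫ Q.map (β_ A B).hom = (β_ _ _).hom ≫ M.mTensor B A :=
  M.lax.braided A B

theorem mTensor_left_unitality (A : C) :
    (M.mUnit ⊗ₘ 𝟙 _) ≫ M.mTensor (𝟙_ C) A ≫ Q.map (λ_ A).hom = (λ_ (Q.obj A)).hom := by
  rw [tensorHom_id]
  exact (M.lax.toLaxMonoidal.left_unitality A).symm

theorem mTensor_right_unitality (A : C) :
    (𝟙 _ ⊗ₘ M.mUnit) ≫ M.mTensor A (𝟙_ C) ≫ Q.map (ρ_ A).hom = (ρ_ (Q.obj A)).hom := by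
  rw [id_tensorHom]
  exact (M.lax.toLaxMonoidal.right_unitality A).symm

/-- The maps `Δ ≫ (!f ⊗ !g)` are compatible with the coactions `δ` and `(δ ⊗ δ) ≫ m_⊗`. -/
theorem comul_map_mTensor {X A B : C} (f : X ⟶ A) (g : X ⟶ B) :
    Q.comul X ≫ (Q.map f ⊗ₘ Q.map g) ≫ (Q.dig A ⊗ₘ Q.dig B) ≫ M.mTensor _ _ =
      Q.dig X ≫ Q.map (Q.comul X ≫ (Q.map f ⊗ₘ Q.map g)) := by
  rw [tensorHom_comp_tensorHom_assoc, Q.map_dig, Q.map_dig, ← tensorHom_comp_tensorHom_assoc,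
    M.mTensor_natural, reassoc_of% M.comul_mTensor, Q.map_comp]

/-- As e is a coalgebra morphism, δ;!(e) = e;m_K; unitality absorbs m_K, and δ;!(ε) = 1 handles the
other factor. -/
theorem dig_mTensor_derCounit (A B : C) :
    (Q.dig A ⊗ₘ Q.dig B) ≫ M.mTensor _ _ ≫ Q.map (Q.derCounit A B) =
      (𝟙 _ ⊗ₘ Q.counit B) ≫ (ρ_ (Q.obj A)).hom := by
  rw [derCounit, Q.map_comp, ← reassoc_of% M.mTensor_natural, tensorHom_comp_tensorHom_assoc,
    Q.dig_map_der, ← M.counit_mUnit, ← M.mTensor_right_unitality, tensorHom_comp_tensorHom_assoc,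
    Category.id_comp]

theorem dig_mTensor_counitDer (A B : C) :
    (Q.dig A ⊗ₘ Q.dig B) ≫ M.mTensor _ _ ≫ Q.map (Q.counitDer A B) =
      (Q.counit A ⊗ₘ 𝟙 _) ≫ (λ_ (Q.obj B)).hom := by
  rw [counitDer, Q.map_comp, ← reassoc_of% M.mTensor_natural, tensorHom_comp_tensorHom_assoc,
    Q.dig_map_der, ← M.counit_mUnit, ← M.mTensor_left_unitality, tensorHom_comp_tensorHom_assoc,
    Category.id_comp]

/-- `(δ ⊗ δ) ≫ m_⊗` is a morphism of comonoids. -/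
theorem dig_mTensor_comul (A B : C) :
    (Q.dig A ⊗ₘ Q.dig B) ≫ M.mTensor _ _ ≫ Q.comul _ =
      (Q.comul A ⊗ₘ Q.comul B) ≫ tensorμ _ _ _ _ ≫
        ((Q.dig A ⊗ₘ Q.dig B) ≫ M.mTensor _ _ ⊗ₘ (Q.dig A ⊗ₘ Q.dig B) ≫ M.mTensor _ _) := by
  rw [M.mTensor_comul, tensorHom_comp_tensorHom_assoc, Q.dig_comul, Q.dig_comul,
    ← tensorHom_comp_tensorHom_assoc, reassoc_of% tensorμ_natural, tensorHom_comp_tensorHom]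

section Pairing
variable {P A B : C} (p : P ⟶ A) (q : P ⟶ B)

theorem pairing_mTensor : (Q.comul P ≫ (Q.map p ⊗ₘ Q.map q)) ≫ M.mTensor A B =
    Q.dig P ≫ Q.map (Q.comul P ≫ (Q.map p ⊗ₘ Q.map q)) ≫ Q.map (Q.der A ⊗ₘ Q.der B) := by
  rw [← reassoc_of% M.comul_map_mTensor, ← M.mTensor_natural, Category.assoc]
  simp only [tensorHom_comp_tensorHom_assoc, Q.dig_map_der, Category.comp_id]

variable {p q}

/-- Moving the pairing inside ! leaves δ;!(χ;l), and χ;l = ε because both have the same two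
projections. -/
theorem pairing_inv {l : Q.obj A ⊗ Q.obj B ⟶ P} (hp : l ≫ p = Q.derCounit A B)
    (hq : l ≫ q = Q.counitDer A B)
    (hom_ext : ∀ {X : C} (f g : X ⟶ P), f ≫ p = g ≫ p → f ≫ q = g ≫ q → f = g) :
    (Q.comul P ≫ (Q.map p ⊗ₘ Q.map q)) ≫ (Q.dig A ⊗ₘ Q.dig B) ≫ M.mTensor _ _ ≫ Q.map l =
      𝟙 _ := by
  have key : (Q.comul P ≫ (Q.map p ⊗ₘ Q.map q)) ≫ l = Q.der P := by
    apply hom_ext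
    · rw [Category.assoc, Category.assoc, hp, Q.map_tensor_derCounit,
        reassoc_of% Q.comul_derCounit]
    · rw [Category.assoc, Category.assoc, hq, Q.map_tensor_counitDer,
        reassoc_of% Q.comul_counitDer]
  rw [Category.assoc, reassoc_of% M.comul_map_mTensor, ← Q.map_comp, key, Q.dig_map_der]

/-- Pushing Δ back through the comonoid morphism (δ⊗δ);m_⊗ leaves one discarding map in each leg;
the counits then cancel the copies. -/
theorem inv_pairing {l : Q.obj A ⊗ Q.obj B ⟶ P} (hp : l ≫ p = Q.derCounit A B)
    (hq : l ≫ q = Q.counitDer A B) :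
    ((Q.dig A ⊗ₘ Q.dig B) ≫ M.mTensor _ _ ≫ Q.map l) ≫ Q.comul P ≫ (Q.map p ⊗ₘ Q.map q) =
      𝟙 _ := by
  rw [Category.assoc, Category.assoc, reassoc_of% Q.map_comul, tensorHom_comp_tensorHom,
    ← Q.map_comp, ← Q.map_comp, hp, hq, reassoc_of% M.dig_mTensor_comul,
    tensorHom_comp_tensorHom, Category.assoc, Category.assoc, M.dig_mTensor_derCounit,
    M.dig_mTensor_counitDer, Q.comul_tensor_comul_counit]

end Pairing

section Seely
variable {A B : C} (c : BinaryFan A B)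

theorem seelyMap_mTensor : Q.seelyMap c ≫ M.mTensor A B =
    Q.dig c.pt ≫ Q.map (Q.seelyMap c) ≫ Q.map (Q.der A ⊗ₘ Q.der B) :=
  M.pairing_mTensor c.fst c.snd

theorem counit_seelyMapTerminal (T : C) : Q.seelyMapTerminal T ≫ M.mUnit =
    Q.dig T ≫ Q.map (Q.seelyMapTerminal T) :=
  M.counit_mUnit T

/-- The inverse of the Seely map. -/
def seelyInv (hc : IsLimit c) : Q.obj A ⊗ Q.obj B ⟶ Q.obj c.pt :=
  (Q.dig A ⊗ₘ Q.dig B) ≫ M.mTensor (Q.obj A) (Q.obj B) ≫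
    Q.map (hc.lift (BinaryFan.mk (Q.derCounit A B) (Q.counitDer A B)))

variable {c}

theorem seelyMap_seelyInv (hc : IsLimit c) : Q.seelyMap c ≫ M.seelyInv c hc = 𝟙 _ :=
  M.pairing_inv (p := c.fst) (q := c.snd) (hc.fac _ ⟨WalkingPair.left⟩)
    (hc.fac _ ⟨WalkingPair.right⟩) fun _ _ h₁ h₂ => BinaryFan.IsLimit.hom_ext hc h₁ h₂

theorem seelyInv_seelyMap (hc : IsLimit c) : M.seelyInv c hc ≫ Q.seelyMap c = 𝟙 _ :=
  M.inv_pairing (p := c.fst) (q := c.snd) (hc.fac _ ⟨WalkingPair.left⟩)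
    (hc.fac _ ⟨WalkingPair.right⟩)

theorem isIso_seelyMap (M : Q.MonoidalStructure) (hc : IsLimit c) : IsIso (Q.seelyMap c) :=
  ⟨M.seelyInv c hc, M.seelyMap_seelyInv hc, M.seelyInv_seelyMap hc⟩

theorem seelyMapTerminal_inv {T : C} (hT : IsTerminal T) :
    Q.seelyMapTerminal T ≫ M.mUnit ≫ Q.map (hT.from (𝟙_ C)) = 𝟙 _ := by
  rw [reassoc_of% M.counit_seelyMapTerminal, ← Q.map_comp, ← Q.dig_map_der]
  exact congrArg _ (congrArg _ (hT.hom_ext _ _))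

theorem inv_seelyMapTerminal {T : C} (hT : IsTerminal T) :
    (M.mUnit ≫ Q.map (hT.from (𝟙_ C))) ≫ Q.seelyMapTerminal T = 𝟙 _ := by
  rw [seelyMapTerminal, Category.assoc, Q.map_counit, M.mUnit_counit]

theorem isIso_seelyMapTerminal (M : Q.MonoidalStructure) {T : C} (hT : IsTerminal T) : IsIso (Q.seelyMapTerminal T) :=
  ⟨M.mUnit ≫ Q.map (hT.from (𝟙_ C)), M.seelyMapTerminal_inv hT, M.inv_seelyMapTerminal hT⟩

theorem isMonoidalStorage (M : Q.MonoidalStructure) [HasFiniteProducts C] : Q.IsMonoidalStorage where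
  hasFiniteProducts := inferInstance
  isIso_seelyMap _ hc := M.isIso_seelyMap hc
  isIso_seelyMapTerminal hT := M.isIso_seelyMapTerminal hT

end Seely

/-- A coalgebra modality with Seely isomorphisms has at most one monoidal structure. -/
theorem eq_of_isMonoidalStorage (S : Q.IsMonoidalStorage) (M N : Q.MonoidalStructure) :
    M = N := by
  have := S.hasFiniteProducts
  refine ext (fun A B => ?_) ?_
  · have := S.isIso_seelyMap _ (prodIsProd A B)
    -- After χ, the right-hand side no longer mentions the monoidal structure.
    rw [← cancel_epi (Q.seelyMap (BinaryFan.mk (prod.fst : A ⨯ B ⟶ A) prod.snd)),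
      M.seelyMap_mTensor, N.seelyMap_mTensor]
  · have := S.isIso_seelyMapTerminal (terminalIsTerminal (C := C))
    rw [← cancel_epi (Q.seelyMapTerminal (⊤_ C)), M.counit_seelyMapTerminal,
      N.counit_seelyMapTerminal]

end MonoidalStructure

/-- The monoidal structure of a monoidal storage category. -/
noncomputable def IsMonoidalStorage.monoidalStructure (S : Q.IsMonoidalStorage) :
    Q.MonoidalStructure :=
  have := S.hasFiniteProducts
  have (A B : C) : IsIso (Q.prodSeely A B) :=
    S.isIso_seelyMap (BinaryFan.mk prod.fst prod.snd) (prodIsProd A B)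
  have : IsIso (Q.counit (⊤_ C)) := S.isIso_seelyMapTerminal terminalIsTerminal
  Q.seelyMonoidalStructure

end CoalgebraModality

/-! ### From a monoidal structure to an additive bialgebra modality -/

namespace CoalgebraModality
variable {C : Type u} [Category.{v} C] [MonoidalCategory C] [SymmetricCategory C]
  {Q : CoalgebraModality C}

namespace MonoidalStructure
variable (M : Q.MonoidalStructure)

theorem isCoalgHom_associator {X Y Z : C} (x : X ⟶ Q.obj X) (y : Y ⟶ Q.obj Y)
    (z : Z ⟶ Q.obj Z) :
    Q.IsCoalgHom (M.tensorator.coact (M.tensorator.coact x y) z)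
      (M.tensorator.coact x (M.tensorator.coact y z)) (α_ X Y Z).hom := by
  have e₁ : ((x ⊗ₘ y) ≫ M.mTensor X Y ⊗ₘ z) = ((x ⊗ₘ y) ⊗ₘ z) ≫ (M.mTensor X Y ⊗ₘ 𝟙 _) := by
    rw [tensorHom_comp_tensorHom, Category.comp_id]
  have e₂ : (x ⊗ₘ (y ⊗ₘ z) ≫ M.mTensor Y Z) = (x ⊗ₘ y ⊗ₘ z) ≫ (𝟙 _ ⊗ₘ M.mTensor Y Z) := by
    rw [tensorHom_comp_tensorHom, Category.comp_id]
  unfold IsCoalgHom Tensorator.coact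
  change (α_ X Y Z).hom ≫ (x ⊗ₘ (y ⊗ₘ z) ≫ M.mTensor Y Z) ≫ M.mTensor X (Y ⊗ Z) =
    (((x ⊗ₘ y) ≫ M.mTensor X Y ⊗ₘ z) ≫ M.mTensor (X ⊗ Y) Z) ≫ Q.map (α_ X Y Z).hom
  rw [e₁, e₂, Category.assoc, Category.assoc, Category.assoc, M.mTensor_associativity,
    associator_naturality_assoc]

theorem isCoalgHom_leftUnitor (A : C) :
    Q.IsCoalgHom (M.tensorator.coact M.mUnit (Q.dig A)) (Q.dig A) (λ_ (Q.obj A)).hom := by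
  unfold IsCoalgHom Tensorator.coact
  have e : (M.mUnit ⊗ₘ Q.dig A) = (𝟙 _ ⊗ₘ Q.dig A) ≫ (M.mUnit ⊗ₘ 𝟙 _) := by
    rw [tensorHom_comp_tensorHom, Category.comp_id, Category.id_comp]
  rw [e, Category.assoc, Category.assoc]
  refine Eq.trans ?_ (congrArg _ (M.mTensor_left_unitality (Q.obj A)).symm)
  rw [id_tensorHom, leftUnitor_naturality]

theorem isCoalgHom_rightUnitor (A : C) :
    Q.IsCoalgHom (M.tensorator.coact (Q.dig A) M.mUnit) (Q.dig A) (ρ_ (Q.obj A)).hom := by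
  unfold IsCoalgHom Tensorator.coact
  have e : (Q.dig A ⊗ₘ M.mUnit) = (Q.dig A ⊗ₘ 𝟙 _) ≫ (𝟙 _ ⊗ₘ M.mUnit) := by
    rw [tensorHom_comp_tensorHom, Category.comp_id, Category.id_comp]
  rw [e, Category.assoc, Category.assoc]
  refine Eq.trans ?_ (congrArg _ (M.mTensor_right_unitality (Q.obj A)).symm)
  rw [tensorHom_id, rightUnitor_naturality]

theorem dig_mTensor_counit (A B : C) : (Q.dig A ⊗ₘ Q.dig B) ≫ M.mTensor _ _ ≫ Q.counit _ =
    (Q.counit A ⊗ₘ Q.counit B) ≫ (λ_ (𝟙_ C)).hom := by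
  rw [M.mTensor_counit, tensorHom_comp_tensorHom_assoc, Q.dig_counit, Q.dig_counit]

end MonoidalStructure

variable [CMonCategory C]

section
variable (Q)

/-- The map `ε ⊗ e + e ⊗ ε : !A ⊗ !A ⟶ A`. -/
def derSum (A : C) : Q.obj A ⊗ Q.obj A ⟶ A := Q.derCounit A A + Q.counitDer A A

theorem map_tensor_derSum {A B : C} (f : A ⟶ B) :
    (Q.map f ⊗ₘ Q.map f) ≫ Q.derSum B = Q.derSum A ≫ f := by
  rw [derSum, derSum, CMonCategory.comp_add, CMonCategory.add_comp, Q.map_tensor_derCounit,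
    Q.map_tensor_counitDer]

theorem comul_map_derSum {A B : C} (f g : A ⟶ B) :
    Q.comul A ≫ (Q.map f ⊗ₘ Q.map g) ≫ Q.derSum B = Q.der A ≫ (f + g) := by
  rw [derSum, CMonCategory.comp_add, CMonCategory.comp_add, CMonCategory.comp_add,
    Q.map_tensor_derCounit, Q.map_tensor_counitDer, reassoc_of% Q.comul_derCounit,
    reassoc_of% Q.comul_counitDer]

theorem braiding_derSum (A : C) : (β_ (Q.obj A) (Q.obj A)).hom ≫ Q.derSum A = Q.derSum A := by
  rw [derSum, CMonCategory.comp_add, derCounit, counitDer,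
    ← BraidedCategory.braiding_naturality_assoc, ← BraidedCategory.braiding_naturality_assoc,
    braiding_rightUnitor, braiding_leftUnitor, add_comm]

theorem tensor_derSum_left {A X : C} (f : X ⟶ Q.obj A) :
    (f ⊗ₘ 𝟙 _) ≫ Q.derSum A = (f ≫ Q.der A ⊗ₘ Q.counit A) ≫ (ρ_ A).hom +
      (f ≫ Q.counit A ⊗ₘ Q.der A) ≫ (λ_ A).hom := by
  rw [derSum, CMonCategory.comp_add, derCounit, counitDer, tensorHom_comp_tensorHom_assoc,
    tensorHom_comp_tensorHom_assoc, Category.id_comp, Category.id_comp]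

theorem tensor_derSum_right {A X : C} (f : X ⟶ Q.obj A) :
    (𝟙 _ ⊗ₘ f) ≫ Q.derSum A = (Q.der A ⊗ₘ f ≫ Q.counit A) ≫ (ρ_ A).hom +
      (Q.counit A ⊗ₘ f ≫ Q.der A) ≫ (λ_ A).hom := by
  rw [derSum, CMonCategory.comp_add, derCounit, counitDer, tensorHom_comp_tensorHom_assoc,
    tensorHom_comp_tensorHom_assoc, Category.id_comp, Category.id_comp]

end

namespace MonoidalStructure
variable (M : Q.MonoidalStructure)

/-- The multiplication `∇` that is induced by a monoidal structure. -/
def nabla (A : C) : Q.obj A ⊗ Q.obj A ⟶ Q.obj A :=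
  (Q.dig A ⊗ₘ Q.dig A) ≫ M.mTensor (Q.obj A) (Q.obj A) ≫ Q.map (Q.derSum A)

/-- The unit `u` that is induced by a monoidal structure. -/
def nablaUnit (A : C) : 𝟙_ C ⟶ Q.obj A := M.mUnit ≫ Q.map (0 : 𝟙_ C ⟶ A)

theorem nabla_der (A : C) : M.nabla A ≫ Q.der A = Q.derSum A := by
  rw [nabla, Category.assoc, Category.assoc, Q.map_der, reassoc_of% M.mTensor_der,
    tensorHom_comp_tensorHom_assoc, Q.dig_der, id_tensorHom_id, Category.id_comp]

theorem nabla_counit (A : C) : M.nabla A ≫ Q.counit A =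
    (Q.counit A ⊗ₘ Q.counit A) ≫ (λ_ (𝟙_ C)).hom := by
  rw [nabla, Category.assoc, Category.assoc, Q.map_counit, M.dig_mTensor_counit]

theorem nabla_comul (A : C) : M.nabla A ≫ Q.comul A =
    (Q.comul A ⊗ₘ Q.comul A) ≫ tensorμ _ _ _ _ ≫ (M.nabla A ⊗ₘ M.nabla A) := by
  rw [nabla, Category.assoc, Category.assoc, Q.map_comul, reassoc_of% M.dig_mTensor_comul,
    tensorHom_comp_tensorHom, Category.assoc]

theorem map_nabla {A B : C} (f : A ⟶ B) :
    M.nabla A ≫ Q.map f = (Q.map f ⊗ₘ Q.map f) ≫ M.nabla B := by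
  rw [nabla, nabla, tensorHom_comp_tensorHom_assoc, Q.map_dig, ← tensorHom_comp_tensorHom_assoc,
    reassoc_of% M.mTensor_natural, ← Q.map_comp, Q.map_tensor_derSum, Q.map_comp,
    Category.assoc, Category.assoc]

theorem braiding_nabla (A : C) : (β_ _ _).hom ≫ M.nabla A = M.nabla A := by
  rw [nabla, ← BraidedCategory.braiding_naturality_assoc, ← reassoc_of% M.mTensor_braiding,
    ← Q.map_comp, Q.braiding_derSum]

/-- Together with `nabla_der` this characterizes ∇, so the unit and associativity laws can be
checked after ε. -/
theorem isCoalgHom_nabla (A : C) :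
    Q.IsCoalgHom (M.tensorator.coact (Q.dig A) (Q.dig A)) (Q.dig A) (M.nabla A) :=
  (M.tensorator.isCoalgHom_tensor (.dig A) (.dig A)).comp
    ((M.tensorator.isCoalgHom_hom _ _).comp (.map _))

theorem isCoalgHom_nablaUnit (A : C) : Q.IsCoalgHom M.mUnit (Q.dig A) (M.nablaUnit A) :=
  IsCoalgHom.comp (y := Q.dig _) M.mUnit_dig (.map _)

theorem nablaUnit_der (A : C) : M.nablaUnit A ≫ Q.der A = 0 := by
  rw [nablaUnit, Category.assoc, Q.map_der, reassoc_of% M.mUnit_der]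

theorem nablaUnit_counit (A : C) : M.nablaUnit A ≫ Q.counit A = 𝟙 _ := by
  rw [nablaUnit, Category.assoc, Q.map_counit, M.mUnit_counit]

theorem nablaUnit_comul (A : C) : M.nablaUnit A ≫ Q.comul A =
    (λ_ (𝟙_ C)).inv ≫ (M.nablaUnit A ⊗ₘ M.nablaUnit A) := by
  rw [nablaUnit, Category.assoc, Q.map_comul, reassoc_of% M.mUnit_comul,
    tensorHom_comp_tensorHom]

theorem nablaUnit_map {A B : C} (f : A ⟶ B) : M.nablaUnit A ≫ Q.map f = M.nablaUnit B := by
  rw [nablaUnit, nablaUnit, Category.assoc, ← Q.map_comp, CMonCategory.zero_comp]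

theorem map_add_eq_nabla {A B : C} (f g : A ⟶ B) :
    Q.map (f + g) = Q.comul A ≫ (Q.map f ⊗ₘ Q.map g) ≫ M.nabla B := by
  rw [nabla, reassoc_of% M.comul_map_mTensor, ← Q.map_comp, Category.assoc,
    Q.comul_map_derSum, Q.map_comp, reassoc_of% Q.dig_map_der]

/-- Both sides are δ;!(0), since e;0 = 0 = ε;0. -/
theorem map_zero_eq_nablaUnit (A B : C) :
    Q.map (0 : A ⟶ B) = Q.counit A ≫ M.nablaUnit B := by
  rw [nablaUnit, reassoc_of% M.counit_mUnit, ← Q.map_comp, CMonCategory.comp_zero,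
    ← CMonCategory.comp_zero (Q.der A) B, Q.map_comp, reassoc_of% Q.dig_map_der]

variable [MonoidalCMonCategory C]

theorem nablaUnit_nabla (A : C) : (M.nablaUnit A ⊗ₘ 𝟙 _) ≫ M.nabla A = (λ_ _).hom := by
  refine ((M.tensorator.isCoalgHom_tensor (M.isCoalgHom_nablaUnit A) (.id _)).comp
    (M.isCoalgHom_nabla A)).hom_ext (M.isCoalgHom_leftUnitor A) ?_
  rw [Category.assoc, M.nabla_der, Q.tensor_derSum_left, M.nablaUnit_der, M.nablaUnit_counit,
    MonoidalCMonCategory.zero_tensor, CMonCategory.zero_comp, zero_add, id_tensorHom,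
    leftUnitor_naturality]

theorem nabla_nablaUnit (A : C) : (𝟙 _ ⊗ₘ M.nablaUnit A) ≫ M.nabla A = (ρ_ _).hom := by
  refine ((M.tensorator.isCoalgHom_tensor (.id _) (M.isCoalgHom_nablaUnit A)).comp
    (M.isCoalgHom_nabla A)).hom_ext (M.isCoalgHom_rightUnitor A) ?_
  rw [Category.assoc, M.nabla_der, Q.tensor_derSum_right, M.nablaUnit_der, M.nablaUnit_counit,
    MonoidalCMonCategory.tensor_zero, CMonCategory.zero_comp, add_zero, tensorHom_id,
    rightUnitor_naturality]

theorem nabla_assoc (A : C) : (M.nabla A ⊗ₘ 𝟙 _) ≫ M.nabla A =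
    (α_ _ _ _).hom ≫ (𝟙 _ ⊗ₘ M.nabla A) ≫ M.nabla A := by
  refine ((M.tensorator.isCoalgHom_tensor (M.isCoalgHom_nabla A) (.id _)).comp
    (M.isCoalgHom_nabla A)).hom_ext ((M.isCoalgHom_associator _ _ _).comp
      ((M.tensorator.isCoalgHom_tensor (.id _) (M.isCoalgHom_nabla A)).comp
        (M.isCoalgHom_nabla A))) ?_
  simp only [Category.assoc, M.nabla_der, Q.tensor_derSum_left, Q.tensor_derSum_right,
    M.nabla_counit]
  simp only [derSum, derCounit, counitDer, MonoidalCMonCategory.add_tensor,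
    MonoidalCMonCategory.tensor_add, CMonCategory.add_comp, CMonCategory.comp_add]
  -- Each side is now a sum of three maps, with ε on one tensor factor and e on the other two; they
  -- match termwise up to coherence.
  rw [add_assoc]
  congr 1
  · monoidal
  · congr 1 <;> monoidal

/-- The additive bialgebra modality that is induced by a monoidal structure. -/
def additiveBialgebraStructure : Q.AdditiveBialgebraStructure where
  mon A :=
    { one := M.nablaUnit A
      mul := M.nabla A
      one_mul := by rw [← tensorHom_id]; exact M.nablaUnit_nabla A
      mul_one := by rw [← id_tensorHom]; exact M.nabla_nablaUnit A
      mul_assoc := by rw [← tensorHom_id, ← id_tensorHom]; exact M.nabla_assoc A }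
  comm A := @IsCommMonObj.mk _ _ _ _ _ (_) (M.braiding_nabla A)
  map_isMonHom f := @IsMonHom.mk _ _ _ _ _ (_) (_) _ (M.nablaUnit_map f) (M.map_nabla f)
  mul_comul := M.nabla_comul
  one_comul := M.nablaUnit_comul
  mul_counit := M.nabla_counit
  one_counit := M.nablaUnit_counit
  mul_der := M.nabla_der
  map_add := M.map_add_eq_nabla
  map_zero := M.map_zero_eq_nablaUnit

end MonoidalStructure

end CoalgebraModality

/-! ### From an additive bialgebra modality to Seely isomorphisms -/

namespace CoalgebraModality
variable {C : Type u} [Category.{v} C] [MonoidalCategory C] [SymmetricCategory C]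
  [CMonCategory C] {Q : CoalgebraModality C}

namespace AdditiveBialgebraStructure
variable (M : Q.AdditiveBialgebraStructure)

theorem ext {M N : Q.AdditiveBialgebraStructure} (h : ∀ A, M.mul A = N.mul A)
    (h' : ∀ A, M.one A = N.one A) : M = N := by
  have e : M.mon = N.mon := by
    funext A
    have h₁ := h A
    have h₂ := h' A
    unfold BialgebraStructure.mul at h₁
    unfold BialgebraStructure.one at h₂
    revert h₁ h₂
    generalize M.mon A = X
    generalize N.mon A = Y
    intro h₁ h₂
    cases X
    cases Y
    obtain rfl : _ = _ := h₁
    obtain rfl : _ = _ := h₂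
    rfl
  obtain ⟨⟨mon₁, _⟩, _⟩ := M
  obtain ⟨⟨mon₂, _⟩, _⟩ := N
  obtain rfl : mon₁ = mon₂ := e
  rfl

theorem map_mul {A B : C} (f : A ⟶ B) :
    M.mul A ≫ Q.map f = (Q.map f ⊗ₘ Q.map f) ≫ M.mul B :=
  @IsMonHom.mul_hom _ _ _ _ _ (M.mon A) (M.mon B) _ (M.map_isMonHom f)

theorem one_map {A B : C} (f : A ⟶ B) : M.one A ≫ Q.map f = M.one B :=
  @IsMonHom.one_hom _ _ _ _ _ (M.mon A) (M.mon B) _ (M.map_isMonHom f)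

theorem one_mul (A : C) : (M.one A ⊗ₘ 𝟙 _) ≫ M.mul A = (λ_ _).hom := by
  rw [tensorHom_id]
  exact (M.mon A).one_mul

theorem mul_one (A : C) : (𝟙 _ ⊗ₘ M.one A) ≫ M.mul A = (ρ_ _).hom := by
  rw [id_tensorHom]
  exact (M.mon A).mul_one

theorem map_id_map_zero_mul (A B : C) :
    (𝟙 (Q.obj A) ⊗ₘ Q.map (0 : B ⟶ A)) ≫ M.mul A = (𝟙 _ ⊗ₘ Q.counit B) ≫ (ρ_ _).hom := by
  rw [M.map_zero, ← M.mul_one, tensorHom_comp_tensorHom_assoc, Category.comp_id]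

theorem map_zero_map_id_mul (A B : C) :
    (Q.map (0 : A ⟶ B) ⊗ₘ 𝟙 (Q.obj B)) ≫ M.mul B = (Q.counit A ⊗ₘ 𝟙 _) ≫ (λ_ _).hom := by
  rw [M.map_zero, ← M.one_mul, tensorHom_comp_tensorHom_assoc, Category.comp_id]

section Biproduct
variable {P A B : C} {p : P ⟶ A} {q : P ⟶ B} {i : A ⟶ P} {j : B ⟶ P}

theorem pairing_mul (total : p ≫ i + q ≫ j = 𝟙 P) :
    (Q.comul P ≫ (Q.map p ⊗ₘ Q.map q)) ≫ (Q.map i ⊗ₘ Q.map j) ≫ M.mul P = 𝟙 _ := by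
  rw [Category.assoc, tensorHom_comp_tensorHom_assoc, ← Q.map_comp, ← Q.map_comp, ← M.map_add,
    total, Q.map_id]

/-- The bialgebra law splits ∇;Δ into two legs. In each, the cross term i;q or j;p becomes !(0) =
e;u, the unit law absorbs u, and the remaining counits cancel the copies. -/
theorem mul_pairing (hip : i ≫ p = 𝟙 A) (hiq : i ≫ q = 0) (hjp : j ≫ p = 0)
    (hjq : j ≫ q = 𝟙 B) :
    ((Q.map i ⊗ₘ Q.map j) ≫ M.mul P) ≫ Q.comul P ≫ (Q.map p ⊗ₘ Q.map q) = 𝟙 _ := by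
  rw [Category.assoc, reassoc_of% (M.mul_comul P), tensorHom_comp_tensorHom, M.map_mul,
    M.map_mul, tensorHom_comp_tensorHom_assoc, Q.map_comul, Q.map_comul,
    ← tensorHom_comp_tensorHom_assoc, reassoc_of% tensorμ_natural, tensorHom_comp_tensorHom,
    tensorHom_comp_tensorHom_assoc, tensorHom_comp_tensorHom_assoc, ← Q.map_comp, ← Q.map_comp,
    ← Q.map_comp, ← Q.map_comp, hip, hiq, hjp, hjq, Q.map_id, Q.map_id, M.map_id_map_zero_mul,
    M.map_zero_map_id_mul, Q.comul_tensor_comul_counit]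

theorem map_mul_map {d : P ⟶ A} {i j : A ⟶ P} (hi : i ≫ d = 𝟙 A) (hj : j ≫ d = 𝟙 A) :
    ((Q.map i ⊗ₘ Q.map j) ≫ M.mul P) ≫ Q.map d = M.mul A := by
  rw [Category.assoc, M.map_mul, tensorHom_comp_tensorHom_assoc, ← Q.map_comp, ← Q.map_comp, hi,
    hj, Q.map_id, id_tensorHom_id, Category.id_comp]

end Biproduct

/-- On a zero object the identity is 0, so 1 = !(0) = e;u. -/
theorem counit_one {Z : C} (hZ : IsZero Z) : Q.seelyMapTerminal Z ≫ M.one Z = 𝟙 _ :=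
  (M.map_zero Z Z).symm.trans ((congrArg _ (hZ.eq_of_src _ _)).trans (Q.map_id Z))

theorem one_counit_eq_id (Z : C) : M.one Z ≫ Q.seelyMapTerminal Z = 𝟙 _ :=
  M.one_counit Z

theorem seelyMap_mul {A B : C} {b : BinaryBicone A B} (hb : b.IsBilimit) :
    Q.seelyMap b.toCone ≫ (Q.map b.inl ⊗ₘ Q.map b.inr) ≫ M.mul b.pt = 𝟙 _ :=
  M.pairing_mul (CMonCategory.binaryBicone_total hb)

/-- By naturality ∇ is (!ι₀⊗!ι₁);∇ followed by ! of the codiagonal, and χ cancels the first part.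
The right-hand side is independent of ∇, whence uniqueness. -/
theorem seelyMap_mul_eq {A : C} {b : BinaryBicone A A} (hb : b.IsBilimit) :
    Q.seelyMap b.toCone ≫ M.mul A =
      Q.map (hb.isColimit.desc (BinaryCofan.mk (𝟙 A) (𝟙 A))) := by
  have h := M.map_mul_map (d := hb.isColimit.desc (BinaryCofan.mk (𝟙 A) (𝟙 A)))
    (hb.isColimit.fac _ ⟨WalkingPair.left⟩) (hb.isColimit.fac _ ⟨WalkingPair.right⟩)
  refine (congrArg (Q.seelyMap b.toCone ≫ ·) h.symm).trans ?_
  exact (Category.assoc _ _ _).symm.trans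
    ((congrArg (· ≫ _) (M.seelyMap_mul hb)).trans (Category.id_comp _))

theorem counit_one_eq {Z : C} (hZ : IsZero Z) (A : C) :
    Q.seelyMapTerminal Z ≫ M.one A = Q.map (0 : Z ⟶ A) := by
  rw [← M.one_map (0 : Z ⟶ A), reassoc_of% M.counit_one hZ]

theorem isIso_seelyMap (M : Q.AdditiveBialgebraStructure) {A B : C} {c : BinaryFan A B}
    (hc : IsLimit c) : IsIso (Q.seelyMap c) := by
  let i : A ⟶ c.pt := hc.lift (BinaryFan.mk (𝟙 A) 0)
  let j : B ⟶ c.pt := hc.lift (BinaryFan.mk 0 (𝟙 B))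
  have hip : i ≫ c.fst = 𝟙 A := hc.fac _ ⟨WalkingPair.left⟩
  have hiq : i ≫ c.snd = 0 := hc.fac _ ⟨WalkingPair.right⟩
  have hjp : j ≫ c.fst = 0 := hc.fac _ ⟨WalkingPair.left⟩
  have hjq : j ≫ c.snd = 𝟙 B := hc.fac _ ⟨WalkingPair.right⟩
  exact ⟨(Q.map i ⊗ₘ Q.map j) ≫ M.mul c.pt,
    M.pairing_mul (CMonCategory.total_of_hom_ext hip hiq hjp hjq
      fun _ _ h₁ h₂ => BinaryFan.IsLimit.hom_ext hc h₁ h₂),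
    M.mul_pairing hip hiq hjp hjq⟩

theorem isMonoidalStorage (M : Q.AdditiveBialgebraStructure) [HasFiniteProducts C] :
    Q.IsMonoidalStorage where
  hasFiniteProducts := inferInstance
  isIso_seelyMap _ hc := M.isIso_seelyMap hc
  isIso_seelyMapTerminal {T} hT :=
    -- The identity of T and the zero map both end at a terminal object, so they coincide.
    have hZ : IsZero T := (IsZero.iff_id_eq_zero T).2 (hT.hom_ext _ _)
    ⟨M.one T, M.counit_one hZ, M.one_counit_eq_id T⟩

/-- In the presence of biproducts, a coalgebra modality has at most one structure of an
additive bialgebra modality. -/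
theorem eq_of_hasFiniteBiproducts [HasFiniteBiproducts C]
    (M N : Q.AdditiveBialgebraStructure) : M = N := by
  refine ext (fun A => ?_) fun A => ?_
  · have := hasBinaryBiproducts_of_finite_biproducts C
    have := M.isIso_seelyMap (BinaryBiproduct.isBilimit A A).isLimit
    exact (cancel_epi (Q.seelyMap _)).1 ((M.seelyMap_mul_eq (BinaryBiproduct.isBilimit A A)).trans
      (N.seelyMap_mul_eq (BinaryBiproduct.isBilimit A A)).symm)
  · obtain ⟨Z, hZ⟩ := HasZeroObject.zero (C := C)
    have := M.isMonoidalStorage.isIso_seelyMapTerminal hZ.isTerminal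
    rw [← cancel_epi (Q.seelyMapTerminal Z), M.counit_one_eq hZ, N.counit_one_eq hZ]

end AdditiveBialgebraStructure

/-! ### Uniqueness and the bijections -/

theorem LinearWithBiproducts.isMonoidalStorage (L : Q.LinearWithBiproducts) :
    Q.IsMonoidalStorage :=
  have := L.hasFiniteBiproducts
  L.toMonoidalStructure.isMonoidalStorage

theorem BialgebraWithBiproducts.isMonoidalStorage (M : Q.BialgebraWithBiproducts) :
    Q.IsMonoidalStorage :=
  have := M.hasFiniteBiproducts
  M.toAdditiveBialgebraStructure.isMonoidalStorage

instance : Subsingleton Q.LinearWithBiproducts where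
  allEq := by
    rintro ⟨M, hM⟩ ⟨N, hN⟩
    obtain rfl := MonoidalStructure.eq_of_isMonoidalStorage M.isMonoidalStorage M N
    rfl

instance : Subsingleton Q.BialgebraWithBiproducts where
  allEq := by
    rintro ⟨M, hM⟩ ⟨N, hN⟩
    obtain rfl := AdditiveBialgebraStructure.eq_of_hasFiniteBiproducts M N
    rfl

/-- The additive linear category with finite biproducts of an additive monoidal storage
category. -/
noncomputable def IsMonoidalStorage.toLinear (S : Q.IsMonoidalStorage) :
    Q.LinearWithBiproducts where
  toMonoidalStructure := S.monoidalStructure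
  hasFiniteBiproducts :=
    have := S.hasFiniteProducts
    CMonCategory.hasFiniteBiproducts_of_hasFiniteProducts

variable (Q) in
/-- Additive monoidal storage categories are additive linear categories with finite
biproducts. -/
noncomputable def storageEquivLinear : Q.IsMonoidalStorage ≃ Q.LinearWithBiproducts where
  toFun S := S.toLinear
  invFun L := L.isMonoidalStorage
  left_inv _ := rfl
  right_inv _ := Subsingleton.elim _ _

variable (Q) in
/-- Additive linear categories with finite biproducts are additive symmetric monoidal categories
with finite biproducts and an additive bialgebra modality. -/
noncomputable def linearEquivBialgebra [MonoidalCMonCategory C] :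
    Q.LinearWithBiproducts ≃ Q.BialgebraWithBiproducts where
  toFun L :=
    { toAdditiveBialgebraStructure := L.additiveBialgebraStructure
      hasFiniteBiproducts := L.hasFiniteBiproducts }
  -- The way back passes through the Seely isomorphisms; uniqueness on both sides makes the round
  -- trips trivial.
  invFun M := M.isMonoidalStorage.toLinear
  left_inv _ := Subsingleton.elim _ _
  right_inv _ := Subsingleton.elim _ _

end CoalgebraModality

theorem mainTheorem11 {C : Type u} [Category.{v} C] [MonoidalCategory C] [SymmetricCategory C]
    [CMonCategory C] [MonoidalCMonCategory C] (Q : CoalgebraModality C) :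
    ∃ (F : Q.IsMonoidalStorage ≃ Q.LinearWithBiproducts)
      (G : Q.LinearWithBiproducts ≃ Q.BialgebraWithBiproducts),
      -- the monoidal structure in terms of the Seely isomorphisms
      (∀ S : Q.IsMonoidalStorage,
        (∀ {A B : C} (c : BinaryFan A B) (hc : IsLimit c),
          (F S).mTensor A B = (S.seelyIso c hc).inv ≫ Q.dig c.pt ≫ Q.map (Q.seelyMap c) ≫
            Q.map (Q.der A ⊗ₘ Q.der B)) ∧
        (∀ {T : C} (hT : IsTerminal T),
          (F S).mUnit = (S.seelyIsoTerminal hT).inv ≫ Q.dig T ≫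
            Q.map (Q.seelyMapTerminal T))) ∧
      -- the Seely isomorphisms in terms of the monoidal structure
      (∀ L : Q.LinearWithBiproducts,
        (∀ {A B : C} (c : BinaryFan A B) (hc : IsLimit c),
          ((F.symm L).seelyIso c hc).inv = (Q.dig A ⊗ₘ Q.dig B) ≫
            L.mTensor (Q.obj A) (Q.obj B) ≫
              Q.map (hc.lift (BinaryFan.mk (Q.derCounit A B) (Q.counitDer A B)))) ∧
        (∀ {T : C} (hT : IsTerminal T),
          ((F.symm L).seelyIsoTerminal hT).inv = L.mUnit ≫ Q.map (hT.from (𝟙_ C)))) ∧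
      -- the bialgebra structure in terms of the monoidal structure
      (∀ (L : Q.LinearWithBiproducts) (A : C),
        (G L).mul A = (Q.dig A ⊗ₘ Q.dig A) ≫ L.mTensor (Q.obj A) (Q.obj A) ≫
          Q.map (Q.derCounit A A + Q.counitDer A A) ∧
        (G L).one A = L.mUnit ≫ Q.map (0 : 𝟙_ C ⟶ A)) ∧
      -- the bialgebra structure in terms of the Seely isomorphisms
      (∀ (S : Q.IsMonoidalStorage) (A : C),
        (∀ (b : BinaryBicone A A) (hb : b.IsBilimit),
          (G (F S)).mul A = (S.seelyIso b.toCone hb.isLimit).inv ≫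
            Q.map (hb.isColimit.desc (BinaryCofan.mk (𝟙 A) (𝟙 A)))) ∧
        (∀ {Z : C} (hZ : IsZero Z),
          (G (F S)).one A = (S.seelyIsoTerminal hZ.isTerminal).inv ≫ Q.map (0 : Z ⟶ A))) ∧
      -- the Seely isomorphisms in terms of the bialgebra structure
      (∀ M : Q.BialgebraWithBiproducts,
        (∀ {A B : C} (b : BinaryBicone A B) (hb : b.IsBilimit),
          ((F.symm (G.symm M)).seelyIso b.toCone hb.isLimit).inv =
            (Q.map b.inl ⊗ₘ Q.map b.inr) ≫ M.mul b.pt) ∧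
        (∀ {Z : C} (hZ : IsZero Z),
          ((F.symm (G.symm M)).seelyIsoTerminal hZ.isTerminal).inv = M.one Z)) := by
  refine ⟨Q.storageEquivLinear, Q.linearEquivBialgebra, fun S => ⟨fun c hc => ?_, fun hT => ?_⟩,
    fun L => ⟨fun c hc => ?_, fun hT => ?_⟩, fun L A => ⟨rfl, rfl⟩,
    fun S A => ⟨fun b hb => ?_, fun hZ => ?_⟩, fun M => ⟨fun b hb => ?_, fun hZ => ?_⟩⟩
  -- Moving χ to the other side leaves an equation valid in every monoidal structure.
  · rw [Iso.eq_inv_comp]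
    exact S.toLinear.seelyMap_mTensor c
  · rw [Iso.eq_inv_comp]
    exact S.toLinear.counit_seelyMapTerminal _
  -- χ is already known to be invertible, so one composite identifies its inverse.
  · exact Iso.inv_ext (L.seelyMap_seelyInv hc)
  · exact Iso.inv_ext (L.seelyMapTerminal_inv hT)
  · exact (Iso.eq_inv_comp _).2 ((Q.linearEquivBialgebra S.toLinear).seelyMap_mul_eq hb)
  · rw [Iso.eq_inv_comp]
    exact (Q.linearEquivBialgebra S.toLinear).counit_one_eq hZ A
  · exact Iso.inv_ext (M.seelyMap_mul hb)
  · exact Iso.inv_ext (M.counit_one hZ)
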